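/- **Setting.** Let $x>0$ and $\lambda>\mu>0$. A particle starts at $x$ and moves on $[0,\infty)$ with unit speed, initially upward, alternating upward and downward motion; the upward holding times are exponential with rate $\lambda$, the downward ones are exponential with rate $\mu$, and all holding times are independent. Whenever the particle visits the origin and is not absorbed there, it starts afresh upward from the origin with new independent holding times; it is absorbed at its $M$-th visit of the origin, where $M$ is a random variable with values in $\{1,2,\dots\}$, independent of all the holding times. Thus the absorption time is $$A_x(\lambda,\mu)=C_x+\sum_{i=1}^{M-1}C_{0,i},$$ where $C_x$ is the first time at which the particle started at $x$ reaches the origin, and $C_{0,i}$ is the time between the $i$-th and the $(i+1)$-th visit of the origin. Put $$s_M:=\sup\{s\in\mathbb{R}:\mathbb{E}[e^{sM}]<\infty\}\in[0,\infty],$$ $$\Lambda(s;\lambda,\mu):=\frac{\lambda-\mu-\sqrt{(\lambda+\mu-2s)^2-4\lambda\mu}}{2},\qquad H_A(z;\lambda,\mu):=\sup_{s\le(\sqrt\lambda-\sqrt\mu)^2/2}\{sz-\Lambda(s;\lambda,\mu)\}\in[0,\infty].$$ **Proposition 4.1.** Let $x>0$ and $\beta>1$, and assume that $s_M\ge\log\sqrt\beta$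 (the distribution of $M$ does not depend on $\mu$). Then the family $\{A_x(\beta\mu,\mu):\mu>0\}$ satisfies the large deviation principle as $\mu\to\infty$ with speed $\mu$ and good rate function $I_2(z):=x\,H_A(z/x;\beta,1)$, $z\in\mathbb{R}$. That is, $I_2:\mathbb{R}\to[0,\infty]$ is lower semicontinuous, its level sets $\{z: I_2(z)\le\eta\}$, $\eta\ge 0$, are compact, and $$\limsup_{\mu\to\infty}\frac1\mu\log P(A_x(\beta\mu,\mu)\in F)\le-\inf_{z\in F}I_2(z)\quad\text{for all closed } F\subset\mathbb{R},$$ $$\liminf_{\mu\to\infty}\frac1\mu\log P(A_x(\beta\mu,\mu)\in G)\ge-\inf_{z\in G}I_2(z)\quad\text{for all open } G\subset\mathbb{R}.$$ -/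

import Mathlib

open MeasureTheory ProbabilityTheory Filter Topology

noncomputable section

/-! ### Large deviation principles -/

/-- A rate function: lower semicontinuous with values in `[0, ∞]`. -/
structure IsRateFunction {Z : Type*} [TopologicalSpace Z] (I : Z → EReal) : Prop where
  nonneg : ∀ z, 0 ≤ I z
  lowerSemicontinuous : LowerSemicontinuous I

/-- A good rate function: its level sets are compact. -/
structure IsGoodRateFunction {Z : Type*} [TopologicalSpace Z] (I : Z → EReal) : Prop
    extends IsRateFunction I where
  isCompact_levelSet : ∀ η : ℝ, 0 ≤ η → IsCompact {z | I z ≤ (η : EReal)}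

/-- The family of random variables `Y r`, `r > 0`, satisfies the large deviation principle as
`r → ∞`, with speed function `v` and rate function `I`. Here `ENNReal.log 0 = -∞`, and the infimum
over the empty set is `+∞`. -/
structure SatisfiesLDP {Ω Z : Type*} [MeasurableSpace Ω] [TopologicalSpace Z] [MeasurableSpace Z]
    (P : Measure Ω) (Y : ℝ → Ω → Z) (v : ℝ → ℝ) (I : Z → EReal) : Prop where
  aemeasurable : ∀ r : ℝ, 0 < r → AEMeasurable (Y r) P
  tendsto_speed : Tendsto v atTop atTop
  isRateFunction : IsRateFunction I
  upper_bound : ∀ F : Set Z, IsClosed F →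
    limsup (fun r : ℝ => ((1 / v r : ℝ) : EReal) * ENNReal.log (P (Y r ⁻¹' F))) atTop
      ≤ - ⨅ z ∈ F, I z
  lower_bound : ∀ G : Set Z, IsOpen G →
    - ⨅ z ∈ G, I z
      ≤ liminf (fun r : ℝ => ((1 / v r : ℝ) : EReal) * ENNReal.log (P (Y r ⁻¹' G))) atTop

/-! ### The telegraph motion and the absorption time

A path is described by its holding times `h 0, h 1, h 2, …`: the particle moves up with speed one
during the time `h 0`, then down during `h 1`, then up during `h 2`, and so on. -/

/-- The time of the `n`-th change of direction (time `0` for `n = 0`). -/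
def switchTime (h : ℕ → ℝ) (n : ℕ) : ℝ := ∑ k ∈ Finset.range n, h k

/-- The number of changes of direction up to time `t`. -/
def switchCount (h : ℕ → ℝ) (t : ℝ) : ℕ := {n : ℕ | switchTime h (n + 1) ≤ t}.ncard

/-- The position at the time of the `n`-th change of direction, for a particle started at `x`. -/
def switchPosition (x : ℝ) (h : ℕ → ℝ) (n : ℕ) : ℝ :=
  x + ∑ k ∈ Finset.range n, (-1) ^ k * h k

/-- The position at time `t` of the (free) particle started at `x` with upward velocity: the
position at the last change of direction, plus the present velocity times the time elapsed. -/
def telegraphPosition (x : ℝ) (h : ℕ → ℝ) (t : ℝ) : ℝ :=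
  switchPosition x h (switchCount h t) +
    (-1) ^ switchCount h t * (t - switchTime h (switchCount h t))

/-- The first time `t > 0` at which the particle started at `x` is at the origin. (If the switching
rate of the upward motion exceeds that of the downward motion, such a time exists almost surely.) -/
def firstArrival (x : ℝ) (h : ℕ → ℝ) : ℝ :=
  sInf {t : ℝ | 0 < t ∧ telegraphPosition x h t = 0}

/-- `τ i n` is the `n`-th holding time of the motion in the `i`-th cycle (cycle `0` ends with the
first visit of the origin, and every later cycle starts upward from the origin and ends with the
next visit). Upward holding times (`n` even) are exponential with rate `lam`, the downward ones
(`n` odd) are exponential with rate `mu`, and all of them are independent, and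
independent of the number `M` of visits of the origin up to the absorption. -/
structure IsTelegraphMotion {Ω : Type*} [MeasurableSpace Ω] (P : Measure Ω) (lam mu : ℝ)
    (M : Ω → ℕ) (τ : ℕ → ℕ → Ω → ℝ) : Prop where
  hasLaw_up : ∀ i n : ℕ, Even n → HasLaw (τ i n) (expMeasure lam) P
  hasLaw_down : ∀ i n : ℕ, Odd n → HasLaw (τ i n) (expMeasure mu) P
  iIndepFun_holding : iIndepFun (fun p : ℕ × ℕ => τ p.1 p.2) P
  indepFun_visits : IndepFun M (fun ω (p : ℕ × ℕ) => τ p.1 p.2 ω) P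

/-- The absorption time `C_x + ∑_{i=1}^{M-1} C_{0,i}`, where `C_x` is the first arrival time at the
origin from `x`, and `C_{0,i}` is the time between the `i`-th and the next visit of the origin. The
sum is empty if `M = 1`. -/
def absorptionTime {Ω : Type*} (x : ℝ) (M : Ω → ℕ) (τ : ℕ → ℕ → Ω → ℝ) (ω : Ω) : ℝ :=
  firstArrival x (fun n => τ 0 n ω) +
    ∑ i ∈ Finset.Icc 1 (M ω - 1), firstArrival 0 (fun n => τ i n ω)

/-! ### The quantities in the rate function and in the hypothesis -/

/-- `s_M`: the supremum, in `[-∞, ∞]`, of the domain of finiteness of the moment generating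
function of `M`. -/
def mgfDomainSup {Ω : Type*} [MeasurableSpace Ω] (P : Measure Ω) (M : Ω → ℕ) : EReal :=
  ⨆ s ∈ integrableExpSet (fun ω => (M ω : ℝ)) P, (s : EReal)

/-- `Λ(s; lam, mu)`, used for `s ≤ (√lam - √mu)² / 2`. -/
def telegraphLambda (s lam mu : ℝ) : ℝ :=
  (lam - mu - √((lam + mu - 2 * s) ^ 2 - 4 * lam * mu)) / 2

/-- `H_A(z; lam, mu)`, the supremum of `s z - Λ(s; lam, mu)` over `s ≤ (√lam - √mu)² / 2`. -/
def telegraphRate (z lam mu : ℝ) : EReal :=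
  ⨆ s ∈ Set.Iic ((√lam - √mu) ^ 2 / 2), ((s * z - telegraphLambda s lam mu : ℝ) : EReal)

end

/-!
The moment generating function of the first arrival time is never computed from its distribution;
everything rests on one change of measure. Let the switching rates be `a > b`, let `g > 0` with
`b * g < a / g`, and put `s = (a + b - a / g - b * g) / 2` and `L = (a - b - a / g + b * g) / 2`
(`tiltExponent`, `tiltLambda`). On the event that the first arrival from `x` takes place, the density
of the holding times with rates `a`, `b`, multiplied by `exp (s * C_x)`, is `g * exp (L * x)` times
their density with rates `a / g`, `b * g`, because the arrival time and the starting point determine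
the total upward and the total downward time. Hence the law of `C_x`, tilted by `exp (s * c)`, is
`g * exp (L * x)` times the law of `C_x` for the other rates (`lintegral_exp_mul_firstArrival`). This
is proved for functionals truncated to finitely many pairs of motions (`hitFun`), by induction on
their number, conditioning on the first two holding times. The passage to the limit uses that the
particle arrives almost surely when `b < a`, by an exponential martingale bound.

For `a = β`, `b = 1` the numbers `s` run through all exponents below `(√β - 1) ^ 2 / 2` as `g` runs
through `(0, √β)`, and `L = Λ(s)`; multiplying both rates by `μ` multiplies `s` and `L` by `μ`.

* Upper bound. The absorption time has the moment generating function
  `exp (μ * Λ(s) * x) * E[g ^ M]` at `μ * s`, and `E[g ^ M]` is finite for `g < √β` by the assumption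
  on `M`. The exponential Chebyshev inequality on both sides of the mean gives the bound for closed
  sets, since `Λ` lies above its tangent line at `0`.
* Lower bound. Given `z > x`, there is a `g` for which the mean arrival time with rates `β / g` and
  `g` is `z`. By the exponential Chebyshev inequality for these rates, the tilted arrival time
  concentrates at `z` (`tendsto_holdingLaw_abs_sub_ge`), so that `C_x` is near `z` with probability at
  least `exp (-μ * (s * z - x * Λ(s) + ε))` (`le_holdingLaw_abs_sub_lt`), and `s * z - x * Λ(s)` is at
  most the rate at `z`. Fixing a possible value of `M`, the finitely many later cycles are short with
  probability at least `1 / 2` each. The point `z = x` is approached from the right, and to the left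
  of `x` the rate is infinite.
-/

open scoped ENNReal

/-! ### Exponential laws -/

lemma expMeasure_eq_withDensity (a : ℝ) :
    expMeasure a = volume.withDensity (exponentialPDF a) := rfl

lemma measurable_exponentialPDF (a : ℝ) : Measurable (exponentialPDF a) :=
  (measurable_exponentialPDFReal a).ennreal_ofReal

instance nullSingletonClass_expMeasure (a : ℝ) : NullSingletonClass (expMeasure a) := by
  rw [expMeasure_eq_withDensity]; infer_instance

/-- Changing the rate of an exponential law from `a` to `a'`. -/
lemma lintegral_expMeasure_change {a a' : ℝ} (ha : 0 < a) (ha' : 0 < a') {F : ℝ → ℝ≥0∞}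
    (hF : Measurable F) :
    ∫⁻ u, F u ∂expMeasure a =
      ∫⁻ u, ENNReal.ofReal (a / a' * Real.exp (-((a - a') * u))) * F u ∂expMeasure a' := by
  have hm : Measurable fun u : ℝ => ENNReal.ofReal (a / a' * Real.exp (-((a - a') * u))) := by
    fun_prop
  rw [expMeasure_eq_withDensity, expMeasure_eq_withDensity,
    lintegral_withDensity_eq_lintegral_mul _ (measurable_exponentialPDF a) hF,
    lintegral_withDensity_eq_lintegral_mul _ (measurable_exponentialPDF a')
      (g := fun u => ENNReal.ofReal (a / a' * Real.exp (-((a - a') * u))) * F u) (hm.mul hF)]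
  refine lintegral_congr fun u => ?_
  simp only [Pi.mul_apply]
  rw [← mul_assoc]
  congr 1
  rw [exponentialPDF_eq, exponentialPDF_eq]
  split_ifs with hu
  · rw [← ENNReal.ofReal_mul (by positivity)]
    congr 1
    have : Real.exp (-(a * u)) = Real.exp (-(a' * u)) * Real.exp (-((a - a') * u)) := by
      rw [← Real.exp_add]; ring_nf
    rw [this]; field_simp
  · simp

lemma lintegral_exp_mul_expMeasure {a θ : ℝ} (ha : 0 < a) (hθ : θ < a) :
    ∫⁻ u, ENNReal.ofReal (Real.exp (θ * u)) ∂expMeasure a = ENNReal.ofReal (a / (a - θ)) := by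
  have h' : 0 < a - θ := by linarith
  have := isProbabilityMeasure_expMeasure h'
  rw [lintegral_expMeasure_change ha h' (by fun_prop)]
  have : ∀ u : ℝ, ENNReal.ofReal (a / (a - θ) * Real.exp (-((a - (a - θ)) * u))) *
      ENNReal.ofReal (Real.exp (θ * u)) = ENNReal.ofReal (a / (a - θ)) := by
    intro u
    rw [← ENNReal.ofReal_mul (by positivity), mul_assoc, ← Real.exp_add]
    ring_nf
    simp
  simp only [this, lintegral_const, measure_univ, mul_one]

lemma expMeasure_Ici {b y : ℝ} (hb : 0 < b) (hy : 0 ≤ y) :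
    expMeasure b (Set.Ici y) = ENNReal.ofReal (Real.exp (-(b * y))) := by
  have := isProbabilityMeasure_expMeasure hb
  have h1 := cdf_expMeasure_eq hb y
  rw [if_pos hy, cdf_eq_real] at h1
  rw [measure_congr (Ioi_ae_eq_Ici (a := y)).symm, ← ENNReal.ofReal_toReal (measure_ne_top _ _),
    ← Set.compl_Iic]
  congr 1
  have := probReal_compl_eq_one_sub (μ := expMeasure b) (measurableSet_Iic (a := y))
  rw [measureReal_def] at this
  rw [this, h1]; ring

lemma ae_pos_expMeasure {a : ℝ} (ha : 0 < a) : ∀ᵐ u ∂expMeasure a, 0 < u := by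
  have := isProbabilityMeasure_expMeasure ha
  have h := expMeasure_Ici ha le_rfl
  rw [measure_congr (Ioi_ae_eq_Ici (a := (0 : ℝ))).symm, mul_zero, neg_zero, Real.exp_zero,
    ENNReal.ofReal_one] at h
  exact (prob_compl_eq_zero_iff measurableSet_Ioi).2 h

/-! ### Sequences of holding times -/

/-- The sequence with head `u` and tail `h`. -/
def consSeq (u : ℝ) (h : ℕ → ℝ) : ℕ → ℝ
  | 0 => u
  | n + 1 => h n

lemma measurable_consSeq : Measurable fun p : ℝ × (ℕ → ℝ) => consSeq p.1 p.2 := by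
  refine measurable_pi_iff.2 fun n => ?_
  cases n with
  | zero => exact measurable_fst
  | succ n => exact (measurable_pi_apply n).comp measurable_snd

lemma map_consSeq_prod (ν : ℕ → Measure ℝ) [∀ n, IsProbabilityMeasure (ν n)] :
    ((ν 0).prod (Measure.infinitePi fun n => ν (n + 1))).map (fun p => consSeq p.1 p.2) =
      Measure.infinitePi ν := by
  refine Measure.eq_infinitePi _ fun s t ht => ?_
  classical
  -- Boxes may be taken over an initial segment of the indices.
  obtain ⟨N, hN⟩ : ∃ N, s ⊆ Finset.range (N + 1) := by
    obtain ⟨N, hN⟩ := s.exists_nat_subset_range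
    exact ⟨N, hN.trans (Finset.range_mono N.le_succ)⟩
  set t' : ℕ → Set ℝ := fun i => if i ∈ s then t i else Set.univ with ht'
  have ht'm : ∀ i, MeasurableSet (t' i) := fun i => by
    simp only [ht']; split_ifs; exacts [ht i, .univ]
  have e1 : (s : Set ℕ).pi t = (Finset.range (N + 1) : Set ℕ).pi t' := by
    ext h
    simp only [Set.mem_pi, Finset.mem_coe, ht']
    refine ⟨fun H i _ => ?_, fun H i hi => ?_⟩
    · split_ifs with hi
      exacts [H i hi, trivial]
    · simpa [hi] using H i (hN hi)
  have e2 : ∏ i ∈ s, ν i (t i) = ∏ i ∈ Finset.range (N + 1), ν i (t' i) := by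
    rw [← Finset.prod_subset hN (f := fun i => ν i (t' i))]
    · exact Finset.prod_congr rfl fun i hi => by simp [ht', hi]
    · intro i _ hi; simp [ht', hi]
  rw [e1, e2, Measure.map_apply measurable_consSeq
    (.pi (Finset.countable_toSet _) fun i _ => ht'm i), Finset.prod_range_succ']
  have e3 : (fun p : ℝ × (ℕ → ℝ) => consSeq p.1 p.2) ⁻¹' (Finset.range (N + 1) : Set ℕ).pi t' =
      t' 0 ×ˢ (Finset.range N : Set ℕ).pi (fun i => t' (i + 1)) := by
    ext p
    simp only [Set.mem_preimage, Set.mem_pi, Finset.mem_coe, Finset.mem_range, Set.mem_prod]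
    refine ⟨fun H => ⟨H 0 (by omega), fun i hi => H (i + 1) (by omega)⟩, fun H i hi => ?_⟩
    cases i with
    | zero => exact H.1
    | succ i => exact H.2 i (by omega)
  rw [e3, Measure.prod_prod, Measure.infinitePi_pi _ (fun i _ => ht'm _), mul_comm]

/-- The law of the sequence of holding times of one cycle: independent exponential times with
rates `a` (even indices, upward motion) and `b` (odd indices, downward motion). -/
noncomputable def holdingLaw (a b : ℝ) : Measure (ℕ → ℝ) :=
  Measure.infinitePi fun n => if Even n then expMeasure a else expMeasure b

lemma isProbabilityMeasure_ite_expMeasure {a b : ℝ} (ha : 0 < a) (hb : 0 < b) (n : ℕ) :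
    IsProbabilityMeasure (if Even n then expMeasure a else expMeasure b) := by
  split_ifs
  exacts [isProbabilityMeasure_expMeasure ha, isProbabilityMeasure_expMeasure hb]

lemma isProbabilityMeasure_holdingLaw {a b : ℝ} (ha : 0 < a) (hb : 0 < b) :
    IsProbabilityMeasure (holdingLaw a b) := by
  have := isProbabilityMeasure_ite_expMeasure ha hb
  unfold holdingLaw; infer_instance

lemma lintegral_infinitePi_consSeq (ν : ℕ → Measure ℝ) [∀ n, IsProbabilityMeasure (ν n)]
    {F : (ℕ → ℝ) → ℝ≥0∞} (hF : Measurable F) :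
    ∫⁻ h, F h ∂Measure.infinitePi ν =
      ∫⁻ u, ∫⁻ h, F (consSeq u h) ∂Measure.infinitePi (fun n => ν (n + 1)) ∂ν 0 := by
  rw [← map_consSeq_prod, lintegral_map hF measurable_consSeq,
    lintegral_prod (fun p => F (consSeq p.1 p.2)) (hF.comp measurable_consSeq).aemeasurable]

/-- Integration with respect to the first two holding times and to the remaining ones. -/
lemma lintegral_holdingLaw {a b : ℝ} (ha : 0 < a) (hb : 0 < b) {F : (ℕ → ℝ) → ℝ≥0∞}
    (hF : Measurable F) :
    ∫⁻ h, F h ∂holdingLaw a b =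
      ∫⁻ u, ∫⁻ d, ∫⁻ h, F (consSeq u (consSeq d h)) ∂holdingLaw a b ∂expMeasure b
        ∂expMeasure a := by
  have := isProbabilityMeasure_ite_expMeasure ha hb
  have e0 : (if Even 0 then expMeasure a else expMeasure b) = expMeasure a := by simp
  have e1 : (if Even (0 + 1) then expMeasure a else expMeasure b) = expMeasure b := by simp
  have e2 : ∀ n : ℕ, (if Even (n + 1 + 1) then expMeasure a else expMeasure b) =
      if Even n then expMeasure a else expMeasure b := fun n => by
    simp [Nat.even_add_one]
  unfold holdingLaw
  rw [lintegral_infinitePi_consSeq _ hF, e0]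
  refine lintegral_congr fun u => ?_
  have hG : Measurable fun h => F (consSeq u h) :=
    hF.comp (measurable_consSeq.comp measurable_prodMk_left)
  rw [lintegral_infinitePi_consSeq (fun n => if Even (n + 1) then expMeasure a else expMeasure b)
    hG, e1]
  simp_rw [e2]

lemma ae_pos_holdingLaw {a b : ℝ} (ha : 0 < a) (hb : 0 < b) :
    ∀ᵐ h ∂holdingLaw a b, ∀ n, 0 < h n := by
  have := isProbabilityMeasure_ite_expMeasure ha hb
  refine ae_all_iff.2 fun n => ?_
  have h1 : ∀ᵐ u ∂(if Even n then expMeasure a else expMeasure b), 0 < u := by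
    split_ifs
    exacts [ae_pos_expMeasure ha, ae_pos_expMeasure hb]
  exact (measurePreserving_eval_infinitePi
    (fun n => if Even n then expMeasure a else expMeasure b) n).quasiMeasurePreserving.ae h1

/-! ### The path of the particle -/

/-- The sequence of holding times after the first upward and the first downward motion. -/
def dropTwo (h : ℕ → ℝ) : ℕ → ℝ := fun n => h (n + 2)

lemma switchTime_add_two (h : ℕ → ℝ) (n : ℕ) :
    switchTime h (n + 2) = h 0 + h 1 + switchTime (dropTwo h) n := by
  simp only [switchTime, Finset.sum_range_succ' _ (n + 1), Finset.sum_range_succ' _ n, dropTwo]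
  ring

lemma switchPosition_add_two (x : ℝ) (h : ℕ → ℝ) (n : ℕ) :
    switchPosition x h (n + 2) = switchPosition (x + h 0 - h 1) (dropTwo h) n := by
  simp only [switchPosition, Finset.sum_range_succ' _ (n + 1), Finset.sum_range_succ' _ n, dropTwo]
  simp only [pow_add, pow_zero, pow_one]
  norm_num
  ring

lemma strictMono_switchTime {h : ℕ → ℝ} (hh : ∀ n, 0 < h n) : StrictMono (switchTime h) :=
  strictMono_nat_of_lt_succ fun n => by
    simp only [switchTime, Finset.sum_range_succ]; linarith [hh n]

lemma telegraphPosition_eq {h : ℕ → ℝ} (hh : ∀ n, 0 < h n) (x : ℝ) {t : ℝ} {k : ℕ}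
    (h1 : switchTime h k ≤ t) (h2 : t < switchTime h (k + 1)) :
    telegraphPosition x h t = switchPosition x h k + (-1) ^ k * (t - switchTime h k) := by
  have hm := strictMono_switchTime hh
  have : switchCount h t = k := by
    have : {n : ℕ | switchTime h (n + 1) ≤ t} = (Finset.range k : Set ℕ) := by
      ext n
      simp only [Set.mem_ofPred_eq, Finset.coe_range, Set.mem_Iio]
      refine ⟨fun H => ?_, fun H => (hm.monotone H).trans h1⟩
      have := hm.lt_iff_lt.1 (H.trans_lt h2)
      omega
    rw [switchCount, this, Set.ncard_coe_finset, Finset.card_range]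
  rw [telegraphPosition, this]

/-- The interval between consecutive changes of direction that contains a given time. -/
lemma exists_switchTime_le_lt {h : ℕ → ℝ} {t : ℝ} (ht : 0 ≤ t) {m : ℕ}
    (hm : t < switchTime h m) : ∃ k, switchTime h k ≤ t ∧ t < switchTime h (k + 1) := by
  induction m with
  | zero => simp [switchTime] at hm; linarith
  | succ m ih =>
    by_cases H : t < switchTime h m
    · exact ih H
    · exact ⟨m, not_lt.1 H, hm⟩

/-- After the first two holding times the motion starts afresh from the position reached. -/
lemma telegraphPosition_dropTwo {h : ℕ → ℝ} (hh : ∀ n, 0 < h n) (x : ℝ) {t : ℝ} (ht : 0 ≤ t)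
    {m : ℕ} (hm : t < switchTime (dropTwo h) m) :
    telegraphPosition x h (h 0 + h 1 + t) =
      telegraphPosition (x + h 0 - h 1) (dropTwo h) t := by
  obtain ⟨k, h1, h2⟩ := exists_switchTime_le_lt ht hm
  rw [telegraphPosition_eq (h := dropTwo h) (fun n => hh (n + 2)) _ h1 h2,
    telegraphPosition_eq hh x (k := k + 2), switchPosition_add_two, switchTime_add_two, pow_add]
  · ring
  · rw [switchTime_add_two]; linarith
  · rw [add_right_comm, switchTime_add_two]; linarith

lemma telegraphPosition_up {h : ℕ → ℝ} (hh : ∀ n, 0 < h n) (x : ℝ) {t : ℝ} (h1 : 0 ≤ t)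
    (h2 : t < h 0) : telegraphPosition x h t = x + t := by
  rw [telegraphPosition_eq hh x (k := 0)] <;> simp [switchTime, switchPosition, h1, h2]

lemma telegraphPosition_down {h : ℕ → ℝ} (hh : ∀ n, 0 < h n) (x : ℝ) {t : ℝ} (h1 : h 0 ≤ t)
    (h2 : t < h 0 + h 1) : telegraphPosition x h t = x + 2 * h 0 - t := by
  rw [telegraphPosition_eq hh x (k := 1)]
  · simp [switchTime, switchPosition]; ring
  · simpa [switchTime] using h1
  · simpa [switchTime, Finset.sum_range_succ] using h2

lemma telegraphPosition_two {h : ℕ → ℝ} (hh : ∀ n, 0 < h n) (x : ℝ) :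
    telegraphPosition x h (h 0 + h 1) = x + h 0 - h 1 := by
  have h0 := hh 2
  rw [telegraphPosition_eq hh x (k := 2)] <;>
    simp [switchTime, switchPosition, Finset.sum_range_succ, h0]
  ring

/-- The particle started at `x` is at the origin at time `c > 0`, which is before some change of
direction, and it is not there at any time in `(0, c)`. -/
structure IsArrival (x : ℝ) (h : ℕ → ℝ) (c : ℝ) : Prop where
  pos : 0 < c
  eq_zero : telegraphPosition x h c = 0
  ne_zero : ∀ t, 0 < t → t < c → telegraphPosition x h t ≠ 0
  lt_switchTime : ∃ m, c < switchTime h m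

lemma IsArrival.firstArrival_eq {x : ℝ} {h : ℕ → ℝ} {c : ℝ} (H : IsArrival x h c) :
    firstArrival x h = c := by
  refine IsLeast.csInf_eq ⟨⟨H.pos, H.eq_zero⟩, fun t ht => ?_⟩
  by_contra! hlt
  exact H.ne_zero t ht.1 hlt ht.2

lemma isArrival_of_le {h : ℕ → ℝ} (hh : ∀ n, 0 < h n) {x : ℝ} (hx : 0 ≤ x)
    (hit : x + h 0 ≤ h 1) : IsArrival x h (x + 2 * h 0) where
  pos := by linarith [hh 0]
  eq_zero := by
    rcases hit.lt_or_eq with hlt | heq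
    · rw [telegraphPosition_down hh x (by linarith [hh 0]) (by linarith)]; ring
    · rw [show x + 2 * h 0 = h 0 + h 1 by linarith, telegraphPosition_two hh]; linarith
  ne_zero t h1 h2 := by
    rcases lt_or_ge t (h 0) with hlt | hge
    · rw [telegraphPosition_up hh x h1.le hlt]; linarith
    · rw [telegraphPosition_down hh x hge (by linarith)]; linarith
  lt_switchTime := ⟨3, by simp [switchTime, Finset.sum_range_succ]; linarith [hh 2]⟩

lemma IsArrival.add_two {h : ℕ → ℝ} (hh : ∀ n, 0 < h n) {x : ℝ} (hx : 0 ≤ x)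
    (hit : h 1 < x + h 0) {c : ℝ} (H : IsArrival (x + h 0 - h 1) (dropTwo h) c) :
    IsArrival x h (h 0 + h 1 + c) := by
  obtain ⟨m, hm⟩ := H.lt_switchTime
  refine ⟨by linarith [hh 0, hh 1, H.pos], ?_, fun t h1 h2 => ?_,
    ⟨m + 2, by rw [switchTime_add_two]; linarith⟩⟩
  · rw [telegraphPosition_dropTwo hh x H.pos.le hm, H.eq_zero]
  · rcases lt_or_ge t (h 0) with hlt | hge
    · rw [telegraphPosition_up hh x h1.le hlt]; linarith
    rcases lt_or_ge t (h 0 + h 1) with hlt' | hge'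
    · rw [telegraphPosition_down hh x hge hlt']; linarith
    rcases hge'.eq_or_lt with heq | hgt
    · rw [← heq, telegraphPosition_two hh]; linarith
    · have e : t = h 0 + h 1 + (t - (h 0 + h 1)) := by ring
      rw [e, telegraphPosition_dropTwo hh x (by linarith) (m := m) (by linarith)]
      exact H.ne_zero _ (by linarith) (by linarith)

lemma firstArrival_nonneg (x : ℝ) (h : ℕ → ℝ) : 0 ≤ firstArrival x h :=
  Real.sInf_nonneg fun _ ht => ht.1.le

/-! ### Functionals of the first arrival, truncated to finitely many pairs of motions -/

/-- The value at the arrival time of the function `f`, for a particle which is at `x` at time `t`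
and moves according to the holding times `h`; its value is `k` if the particle does not arrive at
the origin during the first `n` pairs of an upward and a downward motion. -/
noncomputable def hitFun (f : ℝ → ℝ≥0∞) (k : ℝ≥0∞) : ℕ → ℝ → ℝ → (ℕ → ℝ) → ℝ≥0∞
  | 0, _, _, _ => k
  | n + 1, x, t, h =>
    if x + h 0 ≤ h 1 then f (t + (x + 2 * h 0))
    else hitFun f k n (x + h 0 - h 1) (t + (h 0 + h 1)) (dropTwo h)

lemma measurable_hitFun {f : ℝ → ℝ≥0∞} (hf : Measurable f) (k : ℝ≥0∞) (n : ℕ) :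
    Measurable fun p : ℝ × ℝ × (ℕ → ℝ) => hitFun f k n p.1 p.2.1 p.2.2 := by
  induction n with
  | zero => exact measurable_const
  | succ n ih =>
    have hd : Measurable dropTwo := measurable_pi_iff.2 fun n => measurable_pi_apply (n + 2)
    have h1 : Measurable fun p : ℝ × ℝ × (ℕ → ℝ) =>
        (p.1 + p.2.2 0 - p.2.2 1, p.2.1 + (p.2.2 0 + p.2.2 1), dropTwo p.2.2) :=
      Measurable.prodMk (by fun_prop) (Measurable.prodMk (by fun_prop) (hd.comp (by fun_prop)))
    exact Measurable.ite (measurableSet_le (by fun_prop) (by fun_prop))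
      (hf.comp (by fun_prop)) (ih.comp h1)

lemma measurable_hitFun_apply {f : ℝ → ℝ≥0∞} (hf : Measurable f) (k : ℝ≥0∞) (n : ℕ) (x t : ℝ) :
    Measurable (hitFun f k n x t) :=
  (measurable_hitFun hf k n).comp (measurable_prodMk_left.comp measurable_prodMk_left)

lemma hitFun_le_succ (f : ℝ → ℝ≥0∞) (n : ℕ) (x t : ℝ) (h : ℕ → ℝ) :
    hitFun f 0 n x t h ≤ hitFun f 0 (n + 1) x t h := by
  induction n generalizing x t h with
  | zero => exact zero_le
  | succ n ih =>
    rw [hitFun, hitFun]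
    split_ifs
    · exact le_rfl
    · exact ih _ _ _

lemma hitFun_zero_one_eq (n : ℕ) (x t : ℝ) (h : ℕ → ℝ) :
    hitFun 0 1 n x t h = 0 ∨ hitFun 0 1 n x t h = 1 ∧ ∀ f, hitFun f 0 n x t h = 0 := by
  induction n generalizing x t h with
  | zero => exact .inr ⟨rfl, fun _ => rfl⟩
  | succ n ih =>
    simp only [hitFun]
    split_ifs
    · exact .inl rfl
    · exact ih _ _ _

/-- If the particle arrives during the first `n` pairs of motions, then `hitFun` is evaluated at
the first arrival time. -/
lemma hitFun_eq_of_hit {h : ℕ → ℝ} (hh : ∀ n, 0 < h n) {n : ℕ} {x t : ℝ} (hx : 0 ≤ x)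
    (H : hitFun 0 1 n x t h = 0) :
    ∃ c, IsArrival x h c ∧ ∀ f k, hitFun f k n x t h = f (t + c) := by
  induction n generalizing x t h with
  | zero => exact absurd H one_ne_zero
  | succ n ih =>
    rw [hitFun] at H
    split_ifs at H with hit
    · exact ⟨_, isArrival_of_le hh hx hit, fun f k => by rw [hitFun, if_pos hit]⟩
    · rw [not_le] at hit
      obtain ⟨c, hc, hf⟩ := ih (h := dropTwo h) (fun n => hh (n + 2)) (by linarith) H
      refine ⟨_, hc.add_two hh hx hit, fun f k => ?_⟩
      rw [hitFun, if_neg (not_le.2 hit), hf, add_assoc]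

lemma iSup_hitFun_eq {h : ℕ → ℝ} (hh : ∀ n, 0 < h n) {x : ℝ} (hx : 0 ≤ x)
    (H : ∃ n, hitFun 0 1 n x 0 h = 0) (f : ℝ → ℝ≥0∞) :
    ⨆ n, hitFun f 0 n x 0 h = f (firstArrival x h) := by
  have key : ∀ n, hitFun 0 1 n x 0 h = 0 → hitFun f 0 n x 0 h = f (firstArrival x h) := by
    intro n hn
    obtain ⟨c, hc, hf⟩ := hitFun_eq_of_hit hh hx hn
    rw [hf, zero_add, hc.firstArrival_eq]
  obtain ⟨n, hn⟩ := H
  refine le_antisymm (iSup_le fun m => ?_)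
    ((key n hn).ge.trans (le_iSup (fun n => hitFun f 0 n x 0 h) n))
  rcases hitFun_zero_one_eq m x 0 h with hm | hm
  · exact (key m hm).le
  · rw [hm.2]; exact zero_le

/-! ### The first pair of motions -/

lemma lintegral_hitFun_succ {a b : ℝ} (ha : 0 < a) (hb : 0 < b) {f : ℝ → ℝ≥0∞}
    (hf : Measurable f) (k : ℝ≥0∞) (n : ℕ) (x t : ℝ) :
    ∫⁻ h, hitFun f k (n + 1) x t h ∂holdingLaw a b =
      ∫⁻ u, ∫⁻ d, (if x + u ≤ d then f (t + (x + 2 * u)) else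
        ∫⁻ h, hitFun f k n (x + u - d) (t + (u + d)) h ∂holdingLaw a b) ∂expMeasure b
          ∂expMeasure a := by
  have := isProbabilityMeasure_holdingLaw ha hb
  rw [lintegral_holdingLaw ha hb (measurable_hitFun_apply hf k (n + 1) x t)]
  refine lintegral_congr fun u => lintegral_congr fun d => ?_
  have e : ∀ h, hitFun f k (n + 1) x t (consSeq u (consSeq d h)) =
      if x + u ≤ d then f (t + (x + 2 * u)) else hitFun f k n (x + u - d) (t + (u + d)) h :=
    fun h => rfl
  simp_rw [e]
  split_ifs
  · simp
  · rfl

/-! ### Arrival is almost sure -/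

lemma measurable_lintegral_hitFun {a b : ℝ} (ha : 0 < a) (hb : 0 < b) {f : ℝ → ℝ≥0∞}
    (hf : Measurable f) (k : ℝ≥0∞) (n : ℕ) :
    Measurable fun p : ℝ × ℝ => ∫⁻ h, hitFun f k n p.1 p.2 h ∂holdingLaw a b := by
  have := isProbabilityMeasure_holdingLaw ha hb
  have hm : Measurable fun q : (ℝ × ℝ) × (ℕ → ℝ) => hitFun f k n q.1.1 q.1.2 q.2 :=
    (measurable_hitFun hf k n).comp
      (f := fun q : (ℝ × ℝ) × (ℕ → ℝ) => (q.1.1, q.1.2, q.2)) (by fun_prop)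
  exact hm.lintegral_prod_right'

/-- The probability of no arrival during the first `n` pairs of motions decays geometrically: the
exponential martingale bound with parameter `(a - b) / 2`. -/
lemma lintegral_hitFun_zero_one_le {a b : ℝ} (hb : 0 < b) (hab : b < a) (n : ℕ) {x : ℝ}
    (hx : 0 ≤ x) (t : ℝ) :
    ∫⁻ h, hitFun 0 1 n x t h ∂holdingLaw a b ≤
      ENNReal.ofReal (Real.exp ((a - b) / 2 * x) * (4 * a * b / (a + b) ^ 2) ^ n) := by
  have ha : 0 < a := hb.trans hab
  have := isProbabilityMeasure_holdingLaw ha hb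
  induction n generalizing x t with
  | zero =>
    have : 0 ≤ (a - b) / 2 * x := mul_nonneg (by linarith) hx
    simpa [hitFun] using this
  | succ n ih =>
    set θ := (a - b) / 2 with hθ
    set r := 4 * a * b / (a + b) ^ 2 with hr
    have hr0 : 0 ≤ r := by positivity
    have e2 : a / (a - θ) * (b / (b - -θ)) = r := by
      have : a - θ = (a + b) / 2 := by rw [hθ]; ring
      rw [this, show b - -θ = (a + b) / 2 by rw [hθ]; ring, hr]
      have : a + b ≠ 0 := by positivity
      field_simp; ring
    rw [lintegral_hitFun_succ ha hb measurable_zero]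
    calc _ ≤ ∫⁻ u, ∫⁻ d, ENNReal.ofReal (Real.exp (θ * x) * r ^ n) *
          ENNReal.ofReal (Real.exp (θ * u)) * ENNReal.ofReal (Real.exp (-θ * d)) ∂expMeasure b
            ∂expMeasure a := by
          refine lintegral_mono fun u => lintegral_mono fun d => ?_
          dsimp only
          split_ifs with hit
          · exact zero_le
          · refine (ih (by linarith) _).trans (le_of_eq ?_)
            rw [← ENNReal.ofReal_mul (by positivity), ← ENNReal.ofReal_mul (by positivity)]
            congr 1
            have : θ * (x + u - d) = θ * x + θ * u + -θ * d := by ring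
            rw [this, Real.exp_add, Real.exp_add]; ring
      _ = _ := by
          have hθa : θ < a := by rw [hθ]; linarith
          have hθb : -θ < b := by rw [hθ]; linarith
          simp_rw [lintegral_const_mul' _ _ (ENNReal.mul_ne_top ENNReal.ofReal_ne_top
            ENNReal.ofReal_ne_top), lintegral_exp_mul_expMeasure hb hθb, mul_assoc]
          rw [lintegral_const_mul' _ _ ENNReal.ofReal_ne_top,
            lintegral_mul_const' _ _ ENNReal.ofReal_ne_top, lintegral_exp_mul_expMeasure ha hθa,
            ← ENNReal.ofReal_mul (div_nonneg ha.le (by linarith)), e2,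
            ← ENNReal.ofReal_mul (by positivity)]
          congr 1; ring

/-- Downward motion dominates, so the particle arrives at the origin almost surely. -/
lemma ae_exists_hitFun_eq_zero {a b : ℝ} (hb : 0 < b) (hab : b < a) {x : ℝ} (hx : 0 ≤ x) :
    ∀ᵐ h ∂holdingLaw a b, ∃ n, hitFun 0 1 n x 0 h = 0 := by
  have hr : 4 * a * b / (a + b) ^ 2 < 1 := by
    rw [div_lt_one (by nlinarith)]; nlinarith [sq_pos_of_pos (sub_pos.2 hab)]
  have hr0 : 0 ≤ 4 * a * b / (a + b) ^ 2 := by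
    have := hb.trans hab
    positivity
  have hm : Measurable fun h => ⨅ n, hitFun 0 1 n x 0 h :=
    Measurable.iInf fun n => measurable_hitFun_apply measurable_zero 1 n x 0
  have h0 : ∫⁻ h, ⨅ n, hitFun 0 1 n x 0 h ∂holdingLaw a b = 0 := by
    have hlim : Tendsto (fun n : ℕ => ENNReal.ofReal
        (Real.exp ((a - b) / 2 * x) * (4 * a * b / (a + b) ^ 2) ^ n)) atTop (𝓝 0) := by
      have := (tendsto_pow_atTop_nhds_zero_of_lt_one hr0 hr).const_mul
        (Real.exp ((a - b) / 2 * x))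
      rw [mul_zero] at this
      simpa using ENNReal.tendsto_ofReal this
    refine le_antisymm (ge_of_tendsto' hlim fun n => ?_) zero_le
    exact (lintegral_mono fun h => iInf_le _ n).trans
      (lintegral_hitFun_zero_one_le hb hab n hx 0)
  filter_upwards [(lintegral_eq_zero_iff hm).1 h0] with h hh
  by_contra! H
  have : ∀ n, hitFun 0 1 n x 0 h = 1 := fun n =>
    ((hitFun_zero_one_eq n x 0 h).resolve_left (H n)).1
  simp [this] at hh

lemma lintegral_firstArrival {a b : ℝ} (hb : 0 < b) (hab : b < a) {x : ℝ} (hx : 0 ≤ x)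
    {f : ℝ → ℝ≥0∞} (hf : Measurable f) :
    ∫⁻ h, f (firstArrival x h) ∂holdingLaw a b =
      ⨆ n, ∫⁻ h, hitFun f 0 n x 0 h ∂holdingLaw a b := by
  rw [← lintegral_iSup (fun n => measurable_hitFun_apply hf 0 n x 0)
    (monotone_nat_of_le_succ fun n h => hitFun_le_succ f n x 0 h)]
  refine lintegral_congr_ae ?_
  filter_upwards [ae_exists_hitFun_eq_zero hb hab hx, ae_pos_holdingLaw (hb.trans hab) hb]
    with h h1 h2
  exact (iSup_hitFun_eq h2 hx h1 f).symm

lemma aemeasurable_firstArrival {a b : ℝ} (hb : 0 < b) (hab : b < a) {x : ℝ} (hx : 0 ≤ x) :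
    AEMeasurable (firstArrival x) (holdingLaw a b) := by
  refine ⟨fun h => (⨆ n, hitFun ENNReal.ofReal 0 n x 0 h).toReal, (Measurable.iSup fun n =>
    measurable_hitFun_apply ENNReal.measurable_ofReal 0 n x 0).ennreal_toReal, ?_⟩
  filter_upwards [ae_exists_hitFun_eq_zero hb hab hx, ae_pos_holdingLaw (hb.trans hab) hb]
    with h h1 h2
  rw [iSup_hitFun_eq h2 hx h1, ENNReal.toReal_ofReal (firstArrival_nonneg x h)]

/-! ### Change of the switching rates -/

/-- Passing from the switching rates `a`, `b` to `a / g`, `b * g` multiplies the law of the first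
arrival time `c` by a multiple of `exp (s * c)`; this is the exponent `s`. -/
noncomputable def tiltExponent (a b g : ℝ) : ℝ := (a + b - a / g - b * g) / 2

/-- The value of `Λ` at the exponent `tiltExponent a b g`. -/
noncomputable def tiltLambda (a b g : ℝ) : ℝ := (a - b - a / g + b * g) / 2

lemma lintegral_ite_le_expMeasure {b y : ℝ} (hb : 0 < b) (hy : 0 ≤ y) (c : ℝ≥0∞)
    (B : ℝ → ℝ≥0∞) :
    ∫⁻ d, (if y ≤ d then c else B d) ∂expMeasure b =
      c * ENNReal.ofReal (Real.exp (-(b * y))) +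
        ∫⁻ d, (if y ≤ d then 0 else B d) ∂expMeasure b := by
  rw [← expMeasure_Ici hb hy, ← lintegral_indicator_const measurableSet_Ici,
    ← lintegral_add_left (measurable_const.indicator measurableSet_Ici)]
  refine lintegral_congr fun d => ?_
  by_cases h : y ≤ d <;> simp [Set.indicator, h]

lemma lintegral_exp_mul_hitFun {a b g : ℝ} (ha : 0 < a) (hb : 0 < b) (hg : 0 < g)
    {f : ℝ → ℝ≥0∞} (hf : Measurable f) (n : ℕ) {x : ℝ} (hx : 0 ≤ x) (t : ℝ) :
    ∫⁻ h, hitFun (fun c => ENNReal.ofReal (Real.exp (tiltExponent a b g * c)) * f c) 0 n x t h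
        ∂holdingLaw a b =
      ENNReal.ofReal (g * Real.exp (tiltLambda a b g * x + tiltExponent a b g * t)) *
        ∫⁻ h, hitFun f 0 n x t h ∂holdingLaw (a / g) (b * g) := by
  induction n generalizing x t with
  | zero => simp [hitFun]
  | succ n ih =>
    have hag : 0 < a / g := by positivity
    have hbg : 0 < b * g := by positivity
    set s := tiltExponent a b g with hs
    set L := tiltLambda a b g with hL
    have e1 : L + s = a - a / g := by rw [hs, hL, tiltExponent, tiltLambda]; ring
    have e2 : s - L = b - b * g := by rw [hs, hL, tiltExponent, tiltLambda]; ring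
    have hfs : Measurable fun c => ENNReal.ofReal (Real.exp (s * c)) * f c := by fun_prop
    have hJ := measurable_lintegral_hitFun hag hbg hf 0 n
    have hJ' := measurable_lintegral_hitFun ha hb hfs 0 n
    rw [lintegral_hitFun_succ ha hb hfs, lintegral_hitFun_succ hag hbg hf]
    -- The integral over the downward motion, for a fixed duration of the upward one.
    have inner : ∀ u : ℝ, 0 ≤ u →
        ∫⁻ d, (if x + u ≤ d then ENNReal.ofReal (Real.exp (s * (t + (x + 2 * u)))) *
            f (t + (x + 2 * u)) else
          ∫⁻ h, hitFun (fun c => ENNReal.ofReal (Real.exp (s * c)) * f c) 0 n (x + u - d)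
            (t + (u + d)) h ∂holdingLaw a b) ∂expMeasure b =
        ENNReal.ofReal (Real.exp (L * x + s * t + (a - a / g) * u)) *
          ∫⁻ d, (if x + u ≤ d then f (t + (x + 2 * u)) else
            ∫⁻ h, hitFun f 0 n (x + u - d) (t + (u + d)) h ∂holdingLaw (a / g) (b * g))
              ∂expMeasure (b * g) := by
      intro u hu
      have hy : 0 ≤ x + u := by linarith
      rw [lintegral_ite_le_expMeasure hb hy, lintegral_ite_le_expMeasure hbg hy,
        mul_add (ENNReal.ofReal _)]
      congr 1
      · rw [mul_right_comm, ← mul_assoc (ENNReal.ofReal _) (f _), mul_right_comm _ (f _),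
          ← ENNReal.ofReal_mul (by positivity), ← ENNReal.ofReal_mul (by positivity),
          ← Real.exp_add, ← Real.exp_add]
        congr 3
        linear_combination x * e2 + u * e2 + u * e1
      · have hm : Measurable fun d => if x + u ≤ d then 0 else
            ∫⁻ h, hitFun (fun c => ENNReal.ofReal (Real.exp (s * c)) * f c) 0 n (x + u - d)
              (t + (u + d)) h ∂holdingLaw a b :=
          Measurable.ite measurableSet_Ici measurable_const
            (hJ'.comp (f := fun d => (x + u - d, t + (u + d))) (by fun_prop))
        rw [lintegral_expMeasure_change hb hbg hm, ← lintegral_const_mul' _ _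
          ENNReal.ofReal_ne_top]
        refine lintegral_congr fun d => ?_
        split_ifs with hd
        · simp
        · rw [ih (by linarith), ← mul_assoc, ← ENNReal.ofReal_mul (by positivity)]
          congr 2
          have : L * x + s * t + (a - a / g) * u =
              -((b - b * g) * d) + (L * (x + u - d) + s * (t + (u + d))) := by
            linear_combination -d * e2 - u * e1
          have hq : b / (b * g) * g = 1 := by field_simp
          rw [this, Real.exp_add (-((b - b * g) * d))]
          linear_combination (Real.exp (-((b - b * g) * d)) *
            Real.exp (L * (x + u - d) + s * (t + (u + d)))) * hq
    have hpos := ae_pos_expMeasure ha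
    have hm2 : Measurable fun u => ENNReal.ofReal (Real.exp (L * x + s * t + (a - a / g) * u)) *
          ∫⁻ d, (if x + u ≤ d then f (t + (x + 2 * u)) else
            ∫⁻ h, hitFun f 0 n (x + u - d) (t + (u + d)) h ∂holdingLaw (a / g) (b * g))
              ∂expMeasure (b * g) := by
      have := isProbabilityMeasure_expMeasure hbg
      refine Measurable.mul (by fun_prop) ?_
      have hm3 : Measurable fun p : ℝ × ℝ => if x + p.1 ≤ p.2 then f (t + (x + 2 * p.1)) else
            ∫⁻ h, hitFun f 0 n (x + p.1 - p.2) (t + (p.1 + p.2)) h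
              ∂holdingLaw (a / g) (b * g) :=
        Measurable.ite (measurableSet_le (by fun_prop) (by fun_prop)) (hf.comp (by fun_prop))
          (hJ.comp (f := fun p : ℝ × ℝ => (x + p.1 - p.2, t + (p.1 + p.2))) (by fun_prop))
      exact hm3.lintegral_prod_right'
    rw [lintegral_congr_ae (hpos.mono fun u hu => inner u hu.le),
      lintegral_expMeasure_change ha hag hm2, ← lintegral_const_mul' _ _ ENNReal.ofReal_ne_top]
    refine lintegral_congr fun u => ?_
    rw [← mul_assoc, ← ENNReal.ofReal_mul (by positivity)]
    congr 2
    rw [Real.exp_add _ ((a - a / g) * u), Real.exp_neg]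
    field_simp

/-- The law of the first arrival time, tilted by `exp (s * c)`, is a multiple of the law of the
first arrival time of the motion with switching rates `a / g` and `b * g`. -/
lemma lintegral_exp_mul_firstArrival {a b g : ℝ} (hb : 0 < b) (hab : b < a) (hg : 0 < g)
    (hgab : b * g < a / g) {x : ℝ} (hx : 0 ≤ x) {f : ℝ → ℝ≥0∞} (hf : Measurable f) :
    ∫⁻ h, ENNReal.ofReal (Real.exp (tiltExponent a b g * firstArrival x h)) *
        f (firstArrival x h) ∂holdingLaw a b =
      ENNReal.ofReal (g * Real.exp (tiltLambda a b g * x)) *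
        ∫⁻ h, f (firstArrival x h) ∂holdingLaw (a / g) (b * g) := by
  have hfs : Measurable fun c => ENNReal.ofReal (Real.exp (tiltExponent a b g * c)) * f c := by
    fun_prop
  rw [lintegral_firstArrival hb hab hx hfs, lintegral_firstArrival (by positivity) hgab hx hf,
    ENNReal.mul_iSup]
  refine iSup_congr fun n => ?_
  rw [lintegral_exp_mul_hitFun (hb.trans hab) hb hg hf n hx, mul_zero, add_zero]

lemma lintegral_exp_firstArrival {a b g : ℝ} (hb : 0 < b) (hab : b < a) (hg : 0 < g)
    (hgab : b * g < a / g) {x : ℝ} (hx : 0 ≤ x) :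
    ∫⁻ h, ENNReal.ofReal (Real.exp (tiltExponent a b g * firstArrival x h)) ∂holdingLaw a b =
      ENNReal.ofReal (g * Real.exp (tiltLambda a b g * x)) := by
  have hbg : 0 < b * g := by positivity
  have := isProbabilityMeasure_holdingLaw (hbg.trans hgab) hbg
  simpa using lintegral_exp_mul_firstArrival hb hab hg hgab hx (f := fun _ => 1) measurable_const

/-! ### Concentration of the first arrival time -/

lemma tiltExponent_eq {a b g : ℝ} (hg : 0 < g) :
    tiltExponent a b g = (g - 1) / 2 * (a / g - b) := by
  rw [tiltExponent]; field_simp; ring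

lemma tiltLambda_eq {a b g : ℝ} (hg : 0 < g) :
    tiltLambda a b g = (g - 1) / 2 * (a / g + b) := by
  rw [tiltLambda]; field_simp; ring

lemma tiltExponent_mul (a b g r : ℝ) :
    tiltExponent (a * r) (b * r) g = r * tiltExponent a b g := by
  rw [tiltExponent, tiltExponent]; ring

lemma tiltLambda_mul (a b g r : ℝ) :
    tiltLambda (a * r) (b * r) g = r * tiltLambda a b g := by
  rw [tiltLambda, tiltLambda]; ring

lemma holdingLaw_exp_bound {a b g : ℝ} (hb : 0 < b) (hab : b < a) (hg : 0 < g)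
    (hgab : b * g < a / g) {x : ℝ} (hx : 0 ≤ x) (c : ℝ) :
    holdingLaw a b {h | tiltExponent a b g * c ≤ tiltExponent a b g * firstArrival x h} ≤
      ENNReal.ofReal (g * Real.exp (tiltLambda a b g * x - tiltExponent a b g * c)) := by
  set s := tiltExponent a b g
  set L := tiltLambda a b g
  have hm := aemeasurable_firstArrival hb hab hx
  have h1 := mul_meas_ge_le_lintegral₀ (μ := holdingLaw a b)
    (f := fun h => ENNReal.ofReal (Real.exp (s * firstArrival x h))) (by fun_prop)
    (ENNReal.ofReal (Real.exp (s * c)))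
  rw [lintegral_exp_firstArrival hb hab hg hgab hx] at h1
  have e : {h | s * c ≤ s * firstArrival x h} = {h | ENNReal.ofReal (Real.exp (s * c)) ≤
      ENNReal.ofReal (Real.exp (s * firstArrival x h))} := by
    ext h
    simp only [Set.mem_ofPred_eq]
    rw [ENNReal.ofReal_le_ofReal_iff (Real.exp_pos _).le, Real.exp_le_exp]
  rw [← e] at h1
  have h2 : (1 : ℝ≥0∞) =
      ENNReal.ofReal (Real.exp (-(s * c))) * ENNReal.ofReal (Real.exp (s * c)) := by
    rw [← ENNReal.ofReal_mul (by positivity), ← Real.exp_add]; simp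
  rw [← one_mul (holdingLaw a b _), h2, mul_assoc]
  refine (mul_le_mul_right h1 _).trans (le_of_eq ?_)
  rw [← ENNReal.ofReal_mul (by positivity), sub_eq_add_neg, Real.exp_add]
  congr 1; ring

lemma continuousAt_div_add_sub {a b x c : ℝ} :
    ContinuousAt (fun g : ℝ => x * (a / g + b) - c * (a / g - b)) 1 := by
  have : ContinuousAt (fun g : ℝ => a / g) 1 := continuousAt_const.div continuousAt_id one_ne_zero
  fun_prop

/-- Above the mean arrival time `x * (a + b) / (a - b)` the exponential bound is effective for some
positive exponent. -/
lemma exists_tilt_of_gt {a b x c : ℝ} (hab : b < a) (hc : x * (a + b) < c * (a - b)) :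
    ∃ g, 0 < g ∧ b * g < a / g ∧ 0 < tiltExponent a b g ∧
      tiltLambda a b g * x - tiltExponent a b g * c < 0 := by
  have c1 : ContinuousAt (fun g : ℝ => a / g) 1 :=
    continuousAt_const.div continuousAt_id one_ne_zero
  have h1 : ∀ᶠ g in 𝓝 (1 : ℝ), x * (a / g + b) - c * (a / g - b) < 0 :=
    continuousAt_div_add_sub.eventually_lt_const (by simp; linarith)
  have h2 : ∀ᶠ g in 𝓝 (1 : ℝ), b * g < a / g :=
    ContinuousAt.eventually_lt (by fun_prop) c1 (by simpa)
  have h3 : ∀ᶠ g in 𝓝 (1 : ℝ), b < a / g := c1.eventually_const_lt (by simpa)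
  obtain ⟨g, ⟨hg1, hg2, hg3⟩, hg⟩ :=
    (((h1.and (h2.and h3)).filter_mono nhdsWithin_le_nhds).and
      (self_mem_nhdsWithin : Set.Ioi (1 : ℝ) ∈ 𝓝[>] 1)).exists
  have hg : 1 < g := hg
  refine ⟨g, by linarith, hg2, ?_, ?_⟩
  · rw [tiltExponent_eq (by linarith)]
    exact mul_pos (by linarith) (by linarith)
  · rw [tiltExponent_eq (by linarith), tiltLambda_eq (by linarith)]
    nlinarith

/-- Below the mean arrival time `x * (a + b) / (a - b)` the exponential bound is effective for some
negative exponent. -/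
lemma exists_tilt_of_lt {a b x c : ℝ} (hab : b < a) (hc : c * (a - b) < x * (a + b)) :
    ∃ g, 0 < g ∧ b * g < a / g ∧ tiltExponent a b g < 0 ∧
      tiltLambda a b g * x - tiltExponent a b g * c < 0 := by
  have c1 : ContinuousAt (fun g : ℝ => a / g) 1 :=
    continuousAt_const.div continuousAt_id one_ne_zero
  have h1 : ∀ᶠ g in 𝓝 (1 : ℝ), 0 < x * (a / g + b) - c * (a / g - b) :=
    continuousAt_div_add_sub.eventually_const_lt (by simp; linarith)
  have h2 : ∀ᶠ g in 𝓝 (1 : ℝ), b * g < a / g :=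
    ContinuousAt.eventually_lt (by fun_prop) c1 (by simpa)
  have h3 : ∀ᶠ g in 𝓝 (1 : ℝ), b < a / g := c1.eventually_const_lt (by simpa)
  have h4 : ∀ᶠ g in 𝓝 (1 : ℝ), 0 < g := continuousAt_id.eventually_const_lt (by simp)
  obtain ⟨g, ⟨hg1, hg2, hg3, hg4⟩, hg⟩ :=
    (((h1.and (h2.and (h3.and h4))).filter_mono nhdsWithin_le_nhds).and
      (self_mem_nhdsWithin : Set.Iio (1 : ℝ) ∈ 𝓝[<] 1)).exists
  have hg : g < 1 := hg
  refine ⟨g, hg4, hg2, ?_, ?_⟩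
  · rw [tiltExponent_eq hg4]
    exact mul_neg_of_neg_of_pos (by linarith) (by linarith)
  · rw [tiltExponent_eq hg4, tiltLambda_eq hg4]
    nlinarith

lemma tendsto_ofReal_mul_exp_neg (g : ℝ) {κ : ℝ} (hκ : κ < 0) :
    Tendsto (fun r : ℝ => ENNReal.ofReal (g * Real.exp (r * κ))) atTop (𝓝 0) := by
  have h1 : Tendsto (fun r : ℝ => g * Real.exp (r * κ)) atTop (𝓝 (g * 0)) :=
    (Real.tendsto_exp_atBot.comp (tendsto_id.atTop_mul_const_of_neg hκ)).const_mul g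
  simpa using ENNReal.tendsto_ofReal h1

/-- As the switching rates are scaled up, the first arrival time concentrates at its mean `z`. -/
lemma tendsto_holdingLaw_abs_sub_ge {a b : ℝ} (hb : 0 < b) (hab : b < a) {x z δ : ℝ}
    (hx : 0 ≤ x) (hz : x * (a + b) = z * (a - b)) (hδ : 0 < δ) :
    Tendsto (fun r : ℝ => holdingLaw (a * r) (b * r) {h | δ ≤ |firstArrival x h - z|}) atTop
      (𝓝 0) := by
  obtain ⟨g, hg, hgab, hs, hκ⟩ := exists_tilt_of_gt (x := x) (c := z + δ) hab
    (by rw [hz]; nlinarith)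
  obtain ⟨g', hg', hgab', hs', hκ'⟩ := exists_tilt_of_lt (x := x) (c := z - δ) hab
    (by rw [hz]; nlinarith)
  have hlim := (tendsto_ofReal_mul_exp_neg g hκ).add (tendsto_ofReal_mul_exp_neg g' hκ')
  rw [add_zero] at hlim
  refine tendsto_of_tendsto_of_tendsto_of_le_of_le' tendsto_const_nhds hlim
    (Eventually.of_forall fun _ => zero_le) ?_
  filter_upwards [eventually_gt_atTop 0] with r hr
  have scale : ∀ {g : ℝ}, b * g < a / g → b * r * g < a * r / g := fun {g} h => by
    have := mul_lt_mul_of_pos_right h hr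
    calc b * r * g = b * g * r := by ring
      _ < a / g * r := this
      _ = _ := by ring
  have hbr : 0 < b * r := by positivity
  have habr : b * r < a * r := mul_lt_mul_of_pos_right hab hr
  have b1 := holdingLaw_exp_bound hbr habr hg (scale hgab) hx (z + δ)
  have b2 := holdingLaw_exp_bound hbr habr hg' (scale hgab') hx (z - δ)
  rw [tiltExponent_mul, tiltLambda_mul] at b1 b2
  have e : ∀ L s c : ℝ, r * L * x - r * s * c = r * (L * x - s * c) := fun _ _ _ => by ring
  rw [e] at b1 b2
  refine (measure_mono ?_).trans ((measure_union_le _ _).trans (add_le_add b1 b2))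
  intro h hh
  have hh : δ ≤ |firstArrival x h - z| := hh
  rcases le_abs.1 hh with h1 | h1
  · left
    change r * tiltExponent a b g * (z + δ) ≤ r * tiltExponent a b g * firstArrival x h
    exact mul_le_mul_of_nonneg_left (by linarith) (by positivity)
  · right
    change r * tiltExponent a b g' * (z - δ) ≤ r * tiltExponent a b g' * firstArrival x h
    exact mul_le_mul_of_nonpos_left (by linarith) (mul_neg_of_pos_of_neg hr hs').le

/-- A lower bound for the probability that the first arrival time is close to `z`, in terms of
the tilted law. -/
lemma le_holdingLaw_abs_sub_lt {a b g : ℝ} (hb : 0 < b) (hab : b < a) (hg : 0 < g)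
    (hgab : b * g < a / g) {x : ℝ} (hx : 0 ≤ x) (z δ : ℝ) :
    ENNReal.ofReal (g * Real.exp (tiltLambda a b g * x - tiltExponent a b g * z
        - |tiltExponent a b g| * δ)) *
      holdingLaw (a / g) (b * g) {h | |firstArrival x h - z| < δ} ≤
    holdingLaw a b {h | |firstArrival x h - z| < δ} := by
  have hbg : 0 < b * g := by positivity
  have hS : MeasurableSet {c : ℝ | |c - z| < δ} := measurableSet_lt (by fun_prop) (by fun_prop)
  have hmeas : ∀ {a b : ℝ}, 0 < b → b < a →
      NullMeasurableSet {h | |firstArrival x h - z| < δ} (holdingLaw a b) := fun hb hab =>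
    (aemeasurable_firstArrival hb hab hx).nullMeasurable hS
  have key := lintegral_exp_mul_firstArrival hb hab hg hgab hx
    (f := fun c => ENNReal.ofReal (Real.exp (-(tiltExponent a b g * c))) *
      {c : ℝ | |c - z| < δ}.indicator 1 c)
    ((by fun_prop : Measurable fun c : ℝ => ENNReal.ofReal
      (Real.exp (-(tiltExponent a b g * c)))).mul
      (measurable_one.indicator hS))
  set s := tiltExponent a b g
  have e : ∀ h, ENNReal.ofReal (Real.exp (s * firstArrival x h)) *
      (ENNReal.ofReal (Real.exp (-(s * firstArrival x h))) *
        {c : ℝ | |c - z| < δ}.indicator 1 (firstArrival x h)) =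
      {h | |firstArrival x h - z| < δ}.indicator 1 h := fun h => by
    rw [← mul_assoc, ← ENNReal.ofReal_mul (by positivity), ← Real.exp_add, add_neg_cancel,
      Real.exp_zero, ENNReal.ofReal_one, one_mul]
    rfl
  simp_rw [e] at key
  rw [lintegral_indicator_one₀ (hmeas hb hab)] at key
  rw [key, sub_sub, sub_eq_add_neg, Real.exp_add, ← mul_assoc, ENNReal.ofReal_mul (by positivity),
    mul_assoc]
  refine mul_le_mul_right ?_ _
  rw [← lintegral_indicator_one₀ (hmeas hbg hgab),
    ← lintegral_const_mul' _ _ ENNReal.ofReal_ne_top]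
  refine lintegral_mono fun h => ?_
  by_cases hh : |firstArrival x h - z| < δ
  · have h1 : s * (firstArrival x h - z) ≤ |s| * δ :=
      (le_abs_self _).trans (by rw [abs_mul]; gcongr)
    simp only [Set.indicator, Set.mem_ofPred_eq, hh, if_true, Pi.one_apply, mul_one]
    exact ENNReal.ofReal_le_ofReal (Real.exp_le_exp.2 (by linarith))
  · simp [Set.indicator, hh]

/-! ### The absorption time as a random sum of independent arrival times -/

section Motion

variable {Ω : Type*} [MeasurableSpace Ω] {P : Measure Ω} {a b : ℝ}
  {M : Ω → ℕ} {τ : ℕ → ℕ → Ω → ℝ}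

lemma IsTelegraphMotion.hasLaw (H : IsTelegraphMotion P a b M τ) (i n : ℕ) :
    HasLaw (τ i n) (if Even n then expMeasure a else expMeasure b) P := by
  split_ifs with hn
  · exact H.hasLaw_up i n hn
  · exact H.hasLaw_down i n (Nat.not_even_iff_odd.1 hn)

lemma IsTelegraphMotion.hasLaw_cycle (H : IsTelegraphMotion P a b M τ) (i : ℕ) :
    HasLaw (fun ω n => τ i n ω) (holdingLaw a b) P :=
  (H.iIndepFun_holding.precomp (g := fun n : ℕ => (i, n))
    fun _ _ h => (Prod.mk.inj h).2).hasLaw_infinitePi (fun n => H.hasLaw i n)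
    (aemeasurable_pi_iff.2 fun n => (H.hasLaw i n).aemeasurable)

lemma IsTelegraphMotion.iIndepFun_cycles [IsProbabilityMeasure P] (ha : 0 < a) (hb : 0 < b)
    (H : IsTelegraphMotion P a b M τ) : iIndepFun (fun i ω n => τ i n ω) P := by
  have := isProbabilityMeasure_ite_expMeasure ha hb
  have hm : AEMeasurable (fun ω (p : ℕ × ℕ) => τ p.1 p.2 ω) P :=
    aemeasurable_pi_iff.2 fun p => (H.hasLaw p.1 p.2).aemeasurable
  have h1 := H.iIndepFun_holding.hasLaw_infinitePi (fun p : ℕ × ℕ => H.hasLaw p.1 p.2) hm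
  rw [iIndepFun_iff_map_fun_eq_infinitePi_map₀' fun i => (H.hasLaw_cycle i).aemeasurable]
  simp_rw [(H.hasLaw_cycle _).map_eq]
  have h2 := Measure.infinitePi_map_curry
    (fun (_ n : ℕ) => if Even n then expMeasure a else expMeasure b)
  rw [← h1.map_eq, AEMeasurable.map_map_of_aemeasurable (MeasurableEquiv.measurable _).aemeasurable
    hm] at h2
  exact h2

/-- Up to null sets, the absorption time is a sum of `M` independent arrival times, the first one
started at `x` and the other ones at the origin. -/
lemma IsTelegraphMotion.exists_arrivals [IsProbabilityMeasure P] (hb : 0 < b) (hab : b < a)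
    {x : ℝ} (hx : 0 ≤ x)
    (H : IsTelegraphMotion P a b M τ) (hM_pos : ∀ᵐ ω ∂P, 1 ≤ M ω) :
    ∃ D : ℕ → Ω → ℝ, (∀ i, Measurable (D i)) ∧ iIndepFun D P ∧ IndepFun M (fun ω i => D i ω) P ∧
      (∀ i, P.map (D i) =
        (holdingLaw a b).map (firstArrival (if i = 0 then x else 0))) ∧
      absorptionTime x M τ =ᵐ[P] fun ω => ∑ i ∈ Finset.range (M ω), D i ω := by
  have hC : ∀ i : ℕ, AEMeasurable (firstArrival (if i = 0 then x else 0)) (holdingLaw a b) :=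
    fun i => aemeasurable_firstArrival hb hab (by split_ifs <;> simp [hx])
  have hX := fun i => H.hasLaw_cycle i
  have hCX : ∀ i : ℕ, AEMeasurable (fun ω => firstArrival (if i = 0 then x else 0)
      (fun n => τ i n ω)) P := fun i => by
    have := hC i
    rw [← (hX i).map_eq] at this
    exact this.comp_aemeasurable (hX i).aemeasurable
  have hae : ∀ i, (fun ω => (hC i).mk _ (fun n => τ i n ω)) =ᵐ[P] (hCX i).mk _ := fun i => by
    have h1 : ∀ᵐ h ∂P.map (fun ω n => τ i n ω),
        firstArrival (if i = 0 then x else 0) h = (hC i).mk _ h := by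
      rw [(hX i).map_eq]; exact (hC i).ae_eq_mk
    exact (ae_eq_comp (hX i).aemeasurable h1).symm.trans (hCX i).ae_eq_mk
  refine ⟨fun i => (hCX i).mk _, fun i => (hCX i).measurable_mk, ?_, ?_, fun i => ?_, ?_⟩
  · exact iIndepFun.congr hae
      ((H.iIndepFun_cycles (hb.trans hab) hb).comp _ fun i => (hC i).measurable_mk)
  · have hm : Measurable fun (q : ℕ × ℕ → ℝ) (i : ℕ) => (hC i).mk _ (fun n => q (i, n)) :=
      measurable_pi_iff.2 fun i => (hC i).measurable_mk.comp
        (measurable_pi_iff.2 fun n => measurable_pi_apply (i, n))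
    refine (H.indepFun_visits.comp measurable_id hm).congr .rfl ?_
    filter_upwards [ae_all_iff.2 hae] with ω hω
    exact funext hω
  · have := hC i
    rw [← (hX i).map_eq] at this
    rw [Measure.map_congr (hCX i).ae_eq_mk.symm, ← (hX i).map_eq,
      AEMeasurable.map_map_of_aemeasurable this (hX i).aemeasurable]
    rfl
  · filter_upwards [ae_all_iff.2 fun i => (hCX i).ae_eq_mk, hM_pos] with ω hω hMω
    obtain ⟨m, hm⟩ : ∃ m, M ω = m + 1 := ⟨M ω - 1, by omega⟩
    have h0 := hω 0
    simp only [if_true] at h0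
    rw [absorptionTime, hm, Finset.sum_range_succ', add_comm, h0]
    congr 1
    rw [Nat.add_sub_cancel, ← Finset.Ico_add_one_right_eq_Icc, Finset.sum_Ico_eq_sum_range,
      Nat.add_sub_cancel]
    refine Finset.sum_congr rfl fun i _ => ?_
    rw [add_comm 1 i, ← hω (i + 1), if_neg i.succ_ne_zero]

lemma IsTelegraphMotion.aemeasurable_absorptionTime [IsProbabilityMeasure P] (hb : 0 < b)
    (hab : b < a) {x : ℝ}
    (hx : 0 ≤ x) (H : IsTelegraphMotion P a b M τ) (hM : Measurable M)
    (hM_pos : ∀ᵐ ω ∂P, 1 ≤ M ω) : AEMeasurable (absorptionTime x M τ) P := by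
  obtain ⟨D, hD, -, -, -, hA⟩ := H.exists_arrivals hb hab hx hM_pos
  refine ⟨_, ?_, hA⟩
  have : Measurable fun p : ℕ × Ω => ∑ i ∈ Finset.range p.1, D i p.2 :=
    measurable_from_prod_countable_right fun m =>
      (Finset.measurable_fun_sum (Finset.range m) fun i _ => hD i :)
  exact this.comp (hM.prodMk measurable_id)

/-- The moment generating function of the absorption time. -/
lemma IsTelegraphMotion.lintegral_exp_absorptionTime [IsProbabilityMeasure P] {g : ℝ}
    (hb : 0 < b) (hab : b < a)
    (hg : 0 < g) (hgab : b * g < a / g) {x : ℝ} (hx : 0 ≤ x)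
    (H : IsTelegraphMotion P a b M τ) (hM : Measurable M) (hM_pos : ∀ᵐ ω ∂P, 1 ≤ M ω) :
    ∫⁻ ω, ENNReal.ofReal (Real.exp (tiltExponent a b g * absorptionTime x M τ ω)) ∂P =
      ENNReal.ofReal (Real.exp (tiltLambda a b g * x)) * ∫⁻ ω, ENNReal.ofReal g ^ M ω ∂P := by
  obtain ⟨D, hD, hind, hMD, hlaw, hA⟩ := H.exists_arrivals hb hab hx hM_pos
  set s := tiltExponent a b g
  set L := tiltLambda a b g
  have hfac : ∀ i, ∫⁻ ω, ENNReal.ofReal (Real.exp (s * D i ω)) ∂P =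
      ENNReal.ofReal (g * Real.exp (L * (if i = 0 then x else 0))) := fun i => by
    have hx' : 0 ≤ (if i = 0 then x else 0) := by split_ifs <;> simp [hx]
    rw [← lintegral_exp_firstArrival hb hab hg hgab hx',
      ← lintegral_map (f := fun c => ENNReal.ofReal (Real.exp (s * c))) (by fun_prop) (hD i),
      hlaw i, lintegral_map' (by fun_prop) (aemeasurable_firstArrival hb hab hx')]
  have hprod : ∀ m, ∫⁻ ω, ∏ i ∈ Finset.range (m + 1), ENNReal.ofReal (Real.exp (s * D i ω)) ∂P =
      ENNReal.ofReal (Real.exp (L * x)) * ENNReal.ofReal g ^ (m + 1) := fun m => by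
    rw [lintegral_prod_eq_prod_lintegral_of_indepFun _
      (fun i ω => ENNReal.ofReal (Real.exp (s * D i ω)))
      (hind.comp (fun _ c => ENNReal.ofReal (Real.exp (s * c))) (fun _ => by fun_prop))
      (fun i => by have := hD i; fun_prop), Finset.prod_range_succ']
    simp only [hfac]
    simp [ENNReal.ofReal_mul hg.le]
    ring
  have hF : Measurable fun p : ℕ × (ℕ → ℝ) =>
      ∏ i ∈ Finset.range p.1, ENNReal.ofReal (Real.exp (s * p.2 i)) :=
    measurable_from_prod_countable_right fun m => by
      dsimp only; fun_prop
  have hDm : Measurable fun ω i => D i ω := measurable_pi_iff.2 hD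
  calc _ = ∫⁻ ω, ∏ i ∈ Finset.range (M ω), ENNReal.ofReal (Real.exp (s * D i ω)) ∂P := by
        refine lintegral_congr_ae ?_
        filter_upwards [hA] with ω hω
        rw [hω, Finset.mul_sum, Real.exp_sum, ENNReal.ofReal_prod_of_nonneg
          fun _ _ => (Real.exp_pos _).le]
    _ = ∫⁻ m, ∫⁻ y, ∏ i ∈ Finset.range m, ENNReal.ofReal (Real.exp (s * y i))
          ∂P.map (fun ω i => D i ω) ∂P.map M := by
        rw [← lintegral_prod (μ := P.map M) (ν := P.map fun ω i => D i ω) _ hF.aemeasurable,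
          ← (indepFun_iff_map_prod_eq_prod_map_map hM.aemeasurable hDm.aemeasurable).1 hMD,
          lintegral_map hF (hM.prodMk hDm)]
    _ = ∫⁻ m, ENNReal.ofReal (Real.exp (L * x)) * ENNReal.ofReal g ^ m ∂P.map M := by
        refine lintegral_congr_ae ?_
        have hpos : ∀ᵐ m ∂P.map M, 1 ≤ m :=
          (ae_map_iff hM.aemeasurable (measurableSet_Ici (a := 1))).2 hM_pos
        filter_upwards [hpos] with m hm
        obtain ⟨k, rfl⟩ : ∃ k, m = k + 1 := ⟨m - 1, by omega⟩
        rw [← hprod, lintegral_map (by fun_prop) hDm]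
    _ = _ := by
        rw [lintegral_map (measurable_of_countable _) hM, lintegral_const_mul' _ _
          ENNReal.ofReal_ne_top]

lemma IsTelegraphMotion.measure_absorptionTime_le [IsProbabilityMeasure P] {g : ℝ}
    (hb : 0 < b) (hab : b < a)
    (hg : 0 < g) (hgab : b * g < a / g) {x : ℝ} (hx : 0 ≤ x)
    (H : IsTelegraphMotion P a b M τ) (hM : Measurable M) (hM_pos : ∀ᵐ ω ∂P, 1 ≤ M ω) (c : ℝ) :
    P {ω | tiltExponent a b g * c ≤ tiltExponent a b g * absorptionTime x M τ ω} ≤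
      ENNReal.ofReal (Real.exp (tiltLambda a b g * x - tiltExponent a b g * c)) *
        ∫⁻ ω, ENNReal.ofReal g ^ M ω ∂P := by
  have h0 := H.lintegral_exp_absorptionTime hb hab hg hgab hx hM hM_pos
  set s := tiltExponent a b g
  set L := tiltLambda a b g
  have hm := H.aemeasurable_absorptionTime hb hab hx hM hM_pos
  have h1 := mul_meas_ge_le_lintegral₀ (μ := P)
    (f := fun ω => ENNReal.ofReal (Real.exp (s * absorptionTime x M τ ω))) (by fun_prop)
    (ENNReal.ofReal (Real.exp (s * c)))
  have e : {ω | s * c ≤ s * absorptionTime x M τ ω} = {ω | ENNReal.ofReal (Real.exp (s * c)) ≤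
      ENNReal.ofReal (Real.exp (s * absorptionTime x M τ ω))} := by
    ext ω
    simp only [Set.mem_ofPred_eq]
    rw [ENNReal.ofReal_le_ofReal_iff (Real.exp_pos _).le, Real.exp_le_exp]
  rw [h0, ← e] at h1
  have h2 : (1 : ℝ≥0∞) =
      ENNReal.ofReal (Real.exp (-(s * c))) * ENNReal.ofReal (Real.exp (s * c)) := by
    rw [← ENNReal.ofReal_mul (by positivity), ← Real.exp_add]; simp
  rw [← one_mul (P _), h2, mul_assoc]
  refine (mul_le_mul_right h1 _).trans (le_of_eq ?_)
  rw [← mul_assoc, ← ENNReal.ofReal_mul (by positivity), sub_eq_add_neg, Real.exp_add, mul_comm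
    (Real.exp (-(s * c)))]

/-- For each value `m` of the number of visits, the absorption time is close to `z` if the
arrival time of the first cycle is close to `z` and those of the other cycles are close to `0`. -/
lemma IsTelegraphMotion.le_measure_absorptionTime [IsProbabilityMeasure P] (hb : 0 < b)
    (hab : b < a) {x : ℝ} (hx : 0 ≤ x) (H : IsTelegraphMotion P a b M τ) (hM_pos : ∀ᵐ ω ∂P, 1 ≤ M ω)
    (m : ℕ) (z η : ℝ) :
    P (M ⁻¹' {m + 1}) * (holdingLaw a b {h | |firstArrival 0 h - 0| < η} ^ m *
        holdingLaw a b {h | |firstArrival x h - z| < η}) ≤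
      P {ω | |absorptionTime x M τ ω - z| < (m + 1) * η} := by
  obtain ⟨D, hD, hind, hMD, hlaw, hA⟩ := H.exists_arrivals hb hab hx hM_pos
  set B : ℕ → Set ℝ := fun i => {c | |c - (if i = 0 then z else 0)| < η} with hB
  have hBm : ∀ i, MeasurableSet (B i) := fun i => measurableSet_lt (by fun_prop) (by fun_prop)
  have hPB : ∀ i, P (D i ⁻¹' B i) = holdingLaw a b
      {h | |firstArrival (if i = 0 then x else 0) h - (if i = 0 then z else 0)| < η} := fun i => by
    rw [← Measure.map_apply (hD i) (hBm i), hlaw i, Measure.map_apply_of_aemeasurable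
      (aemeasurable_firstArrival hb hab (by split_ifs <;> simp [hx])) (hBm i)]
    rfl
  have h1 := hind.measure_inter_preimage_eq_mul (Finset.range (m + 1)) (sets := B)
    (fun i _ => hBm i)
  rw [Finset.prod_range_succ'] at h1
  simp only [hPB, Nat.add_eq_zero_iff, one_ne_zero, and_false, if_false, if_true,
    Finset.prod_const, Finset.card_range] at h1
  have h2 := hMD.measure_inter_preimage_eq_mul {m + 1}
    {y | ∀ i ∈ Finset.range (m + 1), y i ∈ B i} (measurableSet_singleton _)
    (.pi (Finset.countable_toSet (Finset.range (m + 1))) fun i _ => hBm i)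
  have e : (fun ω i => D i ω) ⁻¹' {y | ∀ i ∈ Finset.range (m + 1), y i ∈ B i} =
      ⋂ i ∈ Finset.range (m + 1), D i ⁻¹' B i := by
    ext ω
    simp only [Set.mem_iInter]
    rfl
  rw [e, h1] at h2
  rw [← h2, ← e]
  refine measure_mono_ae ?_
  filter_upwards [hA] with ω hω hmem
  obtain ⟨hm, hmem⟩ := hmem
  have hm : M ω = m + 1 := hm
  have hmem : ∀ i ∈ Finset.range (m + 1), |D i ω - (if i = 0 then z else 0)| < η := hmem
  change |absorptionTime x M τ ω - z| < (m + 1) * η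
  have hz : z = ∑ i ∈ Finset.range (m + 1), if i = 0 then z else 0 := by
    simp
  rw [hω, hm, hz, ← Finset.sum_sub_distrib]
  calc _ ≤ ∑ i ∈ Finset.range (m + 1), |D i ω - (if i = 0 then z else 0)| :=
        Finset.abs_sum_le_sum_abs _ _
    _ < ∑ i ∈ Finset.range (m + 1), η := Finset.sum_lt_sum_of_nonempty (by simp) hmem
    _ = _ := by simp

end Motion

/-! ### The rate function -/

lemma mul_telegraphRate {x : ℝ} (hx : 0 < x) (z β : ℝ) :
    (x : EReal) * telegraphRate (z / x) β 1 =
      ⨆ s ∈ Set.Iic ((√β - √1) ^ 2 / 2), ((s * z - x * telegraphLambda s β 1 : ℝ) : EReal) := by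
  have hx' : (0 : EReal) < x := by exact_mod_cast hx
  have e : ∀ s : ℝ, ((s * z - x * telegraphLambda s β 1 : ℝ) : EReal) =
      (x : EReal) * ((s * (z / x) - telegraphLambda s β 1 : ℝ) : EReal) := fun s => by
    rw [← EReal.coe_mul]; congr 1; field_simp
  simp_rw [e]
  rw [telegraphRate]
  refine le_antisymm ?_ (iSup₂_le fun s hs => ?_)
  · rw [mul_comm, ← EReal.le_div_iff_mul_le hx' (EReal.coe_ne_top x)]
    refine iSup₂_le fun s hs => ?_
    rw [EReal.le_div_iff_mul_le hx' (EReal.coe_ne_top x), mul_comm]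
    exact le_iSup₂ (f := fun s (_ : s ∈ Set.Iic ((√β - √1) ^ 2 / 2)) =>
      (x : EReal) * ((s * (z / x) - telegraphLambda s β 1 : ℝ) : EReal)) s hs
  · exact mul_le_mul_of_nonneg_left (le_iSup₂ (f := fun s (_ : s ∈ Set.Iic ((√β - √1) ^ 2 / 2)) =>
      ((s * (z / x) - telegraphLambda s β 1 : ℝ) : EReal)) s hs) hx'.le

lemma le_mul_telegraphRate {x : ℝ} (hx : 0 < x) (z : ℝ) {s β : ℝ}
    (hs : s ≤ (√β - √1) ^ 2 / 2) :
    ((s * z - x * telegraphLambda s β 1 : ℝ) : EReal) ≤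
      (x : EReal) * telegraphRate (z / x) β 1 := by
  rw [mul_telegraphRate hx]
  exact le_iSup₂ (f := fun s (_ : s ∈ Set.Iic ((√β - √1) ^ 2 / 2)) =>
      ((s * z - x * telegraphLambda s β 1 : ℝ) : EReal)) s hs

lemma telegraphLambda_zero {β : ℝ} (hβ : 1 < β) : telegraphLambda 0 β 1 = 0 := by
  have : (β + 1 - 2 * 0) ^ 2 - 4 * β * 1 = (β - 1) ^ 2 := by ring
  rw [telegraphLambda, this, Real.sqrt_sq (by linarith)]; ring

lemma maxExponent_pos {β : ℝ} (hβ : 1 < β) : 0 < (√β - √1) ^ 2 / 2 := by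
  have : √1 < √β := Real.sqrt_lt_sqrt zero_le_one hβ
  have := sub_pos.2 this
  positivity

lemma isGoodRateFunction_mul_telegraphRate {x β : ℝ} (hx : 0 < x) (hβ : 1 < β) :
    IsGoodRateFunction fun z : ℝ => (x : EReal) * telegraphRate (z / x) β 1 := by
  have hs := maxExponent_pos hβ
  have hlsc : LowerSemicontinuous fun z : ℝ => (x : EReal) * telegraphRate (z / x) β 1 := by
    simp_rw [mul_telegraphRate hx]
    refine lowerSemicontinuous_biSup fun s _ => Continuous.lowerSemicontinuous ?_
    exact continuous_coe_real_ereal.comp (by fun_prop)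
  refine ⟨⟨fun z => ?_, hlsc⟩, fun η _ => ?_⟩
  · have h0 := le_mul_telegraphRate hx z (s := 0) hs.le
    simpa [telegraphLambda_zero hβ] using h0
  · set s := (√β - √1) ^ 2 / 2
    refine (isCompact_Icc (a := -(η + x * telegraphLambda (-1) β 1))
      (b := (η + x * telegraphLambda s β 1) / s)).of_isClosed_subset
      (hlsc.isClosed_preimage η) fun z hz => ?_
    have hz : (x : EReal) * telegraphRate (z / x) β 1 ≤ η := hz
    have h1 := (le_mul_telegraphRate hx z (β := β) (s := -1)
      (by change (-1 : ℝ) ≤ s; linarith)).trans hz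
    have h2 := (le_mul_telegraphRate hx z (β := β) (s := s) le_rfl).trans hz
    rw [EReal.coe_le_coe_iff] at h1 h2
    refine ⟨by linarith, ?_⟩
    rw [le_div_iff₀ hs]; linarith

/-! ### Parametrisation of the exponents -/

lemma lt_sqrt_of_lt_div {β g : ℝ} (hg : 0 < g) (h : 1 * g < β / g) : g < √β := by
  rw [one_mul, lt_div_iff₀ hg] at h
  exact Real.lt_sqrt_of_sq_lt (by nlinarith)

lemma telegraphLambda_tiltExponent {β g : ℝ} (hg : 0 < g) (h : 1 * g < β / g) :
    telegraphLambda (tiltExponent β 1 g) β 1 = tiltLambda β 1 g := by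
  have : (β + 1 - 2 * tiltExponent β 1 g) ^ 2 - 4 * β * 1 = (β / g - g) ^ 2 := by
    rw [tiltExponent]; field_simp; ring
  rw [telegraphLambda, this, Real.sqrt_sq (by linarith), tiltLambda]; ring

lemma tiltExponent_le {β g : ℝ} (hβ : 1 < β) (hg : 0 < g) :
    tiltExponent β 1 g ≤ (√β - √1) ^ 2 / 2 := by
  have h1 : √β ^ 2 = β := Real.sq_sqrt (by linarith)
  have h2 : 2 * √β ≤ β / g + g := by
    have : β / g + g - 2 * √β = (√β - g) ^ 2 / g := by
      nth_rw 1 [← h1]; field_simp; ring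
    have : 0 ≤ (√β - g) ^ 2 / g := by positivity
    linarith
  rw [tiltExponent, Real.sqrt_one]
  nlinarith

lemma exists_tiltExponent_eq {β s : ℝ} (hβ : 1 < β) (hs : s < (√β - √1) ^ 2 / 2) :
    ∃ g, 0 < g ∧ 1 * g < β / g ∧ tiltExponent β 1 g = s := by
  have h1 : √β ^ 2 = β := Real.sq_sqrt (by linarith)
  have h1' : 0 < √β := Real.sqrt_pos.2 (by linarith)
  set w := β + 1 - 2 * s with hw
  have hw2 : 2 * √β < w := by rw [Real.sqrt_one] at hs; nlinarith
  have hD : 0 < w ^ 2 - 4 * β := by nlinarith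
  set d := √(w ^ 2 - 4 * β) with hd
  have hd2 : d ^ 2 = w ^ 2 - 4 * β := Real.sq_sqrt hD.le
  have hd0 : 0 < d := Real.sqrt_pos.2 hD
  have hdw : d < w := by nlinarith
  have e : β / ((w - d) / 2) = (w + d) / 2 := by
    rw [div_eq_iff (by linarith)]; nlinarith
  refine ⟨(w - d) / 2, by linarith, ?_, ?_⟩
  · rw [e]; linarith
  · rw [tiltExponent, e]; linarith

/-- `Λ` lies above its tangent line at `0`. -/
lemma tiltExponent_mul_le {β g : ℝ} (hβ : 1 < β) (hg : 0 < g) :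
    tiltExponent β 1 g * (β + 1) ≤ tiltLambda β 1 g * (β - 1) := by
  have : tiltLambda β 1 g * (β - 1) - tiltExponent β 1 g * (β + 1) = β * (g - 1) ^ 2 / g := by
    rw [tiltExponent, tiltLambda]; field_simp; ring
  have : 0 ≤ β * (g - 1) ^ 2 / g := by positivity
  linarith

/-- Values below the rate function are reached at exponents in the interior of the domain. -/
lemma exists_tilt_of_lt_rate {x β z r : ℝ} (hx : 0 < x) (hβ : 1 < β)
    (h : (r : EReal) < (x : EReal) * telegraphRate (z / x) β 1) :
    ∃ g, 0 < g ∧ 1 * g < β / g ∧ r < tiltExponent β 1 g * z - x * tiltLambda β 1 g := by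
  rw [mul_telegraphRate hx] at h
  obtain ⟨s, hs⟩ := lt_iSup_iff.1 h
  obtain ⟨hs, hr⟩ := lt_iSup_iff.1 hs
  rw [EReal.coe_lt_coe_iff] at hr
  have hc : Continuous fun s => s * z - x * telegraphLambda s β 1 := by
    unfold telegraphLambda; fun_prop
  obtain ⟨s', hs', hlt⟩ := (((hc.continuousAt.eventually_const_lt hr).filter_mono
    nhdsWithin_le_nhds).and (self_mem_nhdsWithin : Set.Iio s ∈ 𝓝[<] s)).exists
  have hlt : s' < s := hlt
  obtain ⟨g, hg, hgβ, rfl⟩ := exists_tiltExponent_eq hβ (hlt.trans_le hs)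
  exact ⟨g, hg, hgβ, by rwa [telegraphLambda_tiltExponent hg hgβ] at hs'⟩

lemma rate_eq_top {x β z : ℝ} (hx : 0 < x) (hβ : 1 < β) (hz : z < x) :
    (x : EReal) * telegraphRate (z / x) β 1 = ⊤ := by
  refine EReal.eq_top_iff_forall_lt _ |>.2 fun r => ?_
  -- As `g` tends to `0`, the exponent tends to `-∞`, while `Λ(s) = s - 1 + g`.
  have hlim : Tendsto (fun g : ℝ => β * g⁻¹) (𝓝[>] 0) atTop :=
    tendsto_inv_nhdsGT_zero.const_mul_atTop (by linarith)
  obtain ⟨g, hg1, hg, hg2⟩ := ((hlim.eventually_ge_atTop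
    (β + 1 + 2 * ((|r| + x + 1) / (x - z)))).and (Ioo_mem_nhdsGT (zero_lt_one (α := ℝ)))).exists
  have hgβ : 1 * g < β / g := by rw [one_mul, lt_div_iff₀ hg]; nlinarith
  have h1 := le_mul_telegraphRate hx z (tiltExponent_le hβ hg)
  rw [telegraphLambda_tiltExponent hg hgβ] at h1
  refine lt_of_lt_of_le (EReal.coe_lt_coe_iff.2 ?_) h1
  have e1 : tiltLambda β 1 g = tiltExponent β 1 g - 1 + g := by
    rw [tiltExponent, tiltLambda]; ring
  have e2 : tiltExponent β 1 g ≤ -((|r| + x + 1) / (x - z)) := by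
    rw [tiltExponent, div_eq_mul_inv β g]; linarith
  have e3 : (|r| + x + 1) / (x - z) * (x - z) = |r| + x + 1 :=
    div_mul_cancel₀ _ (by linarith)
  rw [e1]
  nlinarith [le_abs_self r]

/-! ### Logarithmic asymptotics -/

lemma tendsto_inv_mul_log {K : ℝ} (hK : 0 < K) (ρ : ℝ) :
    Tendsto (fun r : ℝ => ((1 / r : ℝ) : EReal) *
      ENNReal.log (ENNReal.ofReal (K * Real.exp (r * ρ)))) atTop (𝓝 (ρ : EReal)) := by
  have h1 : Tendsto (fun r : ℝ => r⁻¹ * Real.log K + ρ) atTop (𝓝 ρ) := by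
    simpa using (tendsto_inv_atTop_zero.mul_const (Real.log K)).add_const ρ
  refine ((continuous_coe_real_ereal.tendsto ρ).comp h1).congr' ?_
  filter_upwards [eventually_gt_atTop 0] with r hr
  rw [ENNReal.log_ofReal_of_pos (by positivity), ← EReal.coe_mul, Function.comp_apply,
    Real.log_mul hK.ne' (Real.exp_pos _).ne', Real.log_exp]
  congr 1
  field_simp

lemma limsup_inv_mul_log_le {p : ℝ → ℝ≥0∞} {K ρ : ℝ} (hK : 0 < K)
    (hp : ∀ᶠ r in atTop, p r ≤ ENNReal.ofReal (K * Real.exp (r * ρ))) :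
    limsup (fun r : ℝ => ((1 / r : ℝ) : EReal) * ENNReal.log (p r)) atTop ≤ ρ := by
  rw [← (tendsto_inv_mul_log hK ρ).limsup_eq]
  refine limsup_le_limsup ?_
  filter_upwards [hp, eventually_gt_atTop 0] with r h hr
  exact mul_le_mul_of_nonneg_left (ENNReal.log_le_log h) (by exact_mod_cast (by positivity))

lemma le_liminf_inv_mul_log {p : ℝ → ℝ≥0∞} {K ρ : ℝ} (hK : 0 < K)
    (hp : ∀ᶠ r in atTop, ENNReal.ofReal (K * Real.exp (r * ρ)) ≤ p r) :
    ρ ≤ liminf (fun r : ℝ => ((1 / r : ℝ) : EReal) * ENNReal.log (p r)) atTop := by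
  rw [← (tendsto_inv_mul_log hK ρ).liminf_eq]
  refine liminf_le_liminf ?_
  filter_upwards [hp, eventually_gt_atTop 0] with r h hr
  exact mul_le_mul_of_nonneg_left (ENNReal.log_le_log h) (by exact_mod_cast (by positivity))

/-! ### The large deviation bounds -/

/-- Below `√β` the probability generating function of the number of visits is finite. -/
lemma lintegral_ofReal_pow_ne_top {Ω : Type*} [MeasurableSpace Ω] {P : Measure Ω} {M : Ω → ℕ}
    {β g : ℝ} (hsM : ((Real.log √β : ℝ) : EReal) ≤ mgfDomainSup P M) (hg : 0 < g)
    (hgβ : g < √β) : ∫⁻ ω, ENNReal.ofReal g ^ M ω ∂P ≠ ∞ := by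
  have h1 : ((Real.log g : ℝ) : EReal) < mgfDomainSup P M :=
    lt_of_lt_of_le (EReal.coe_lt_coe_iff.2 (Real.log_lt_log hg hgβ)) hsM
  obtain ⟨t, ht⟩ := lt_iSup_iff.1 h1
  obtain ⟨ht, hlt⟩ := lt_iSup_iff.1 ht
  rw [EReal.coe_lt_coe_iff] at hlt
  have hint : Integrable (fun ω => Real.exp (t * (M ω : ℝ))) P := ht
  refine ((lintegral_mono fun ω => ?_).trans_lt hint.lintegral_lt_top).ne
  rw [← ENNReal.ofReal_pow hg.le]
  refine ENNReal.ofReal_le_ofReal ?_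
  rw [← Real.exp_log (pow_pos hg _), Real.log_pow, mul_comm]
  exact Real.exp_le_exp.2 (mul_le_mul_of_nonneg_right hlt.le (Nat.cast_nonneg _))

lemma half_le_holdingLaw {a b : ℝ} (hb : 0 < b) (hab : b < a) {x z η : ℝ}
    (hx : 0 ≤ x) (hz : x * (a + b) = z * (a - b)) (hη : 0 < η) :
    ∀ᶠ r : ℝ in atTop, 2⁻¹ ≤ holdingLaw (a * r) (b * r) {h | |firstArrival x h - z| < η} := by
  filter_upwards [(tendsto_holdingLaw_abs_sub_ge hb hab hx hz hη).eventually_lt_const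
    (show (0 : ℝ≥0∞) < 2⁻¹ by simp), eventually_gt_atTop 0] with r h1 hr
  have hbr : 0 < b * r := by positivity
  have := isProbabilityMeasure_holdingLaw (mul_pos (hb.trans hab) hr) hbr
  by_contra! h2
  have h3 : (1 : ℝ≥0∞) ≤ holdingLaw (a * r) (b * r) {h | |firstArrival x h - z| < η} +
      holdingLaw (a * r) (b * r) {h | η ≤ |firstArrival x h - z|} := by
    rw [← measure_univ (μ := holdingLaw (a * r) (b * r))]
    refine (measure_mono fun h _ => ?_).trans (measure_union_le _ _)
    exact lt_or_ge |firstArrival x h - z| η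
  have h4 := ENNReal.add_lt_add h2 h1
  rw [ENNReal.inv_two_add_inv_two] at h4
  exact absurd h4 (not_lt.2 h3)

section LargeDeviations

variable {Ω : Type*} [MeasurableSpace Ω] {P : Measure Ω} [IsProbabilityMeasure P] {x β : ℝ}
  {M : Ω → ℕ} {τ : ℝ → ℕ → ℕ → Ω → ℝ}

/-- Exponential Chebyshev bound for the absorption times. -/
lemma exists_measure_absorptionTime_le (hx : 0 < x) (hβ : 1 < β) (hM : Measurable M)
    (hM_pos : ∀ᵐ ω ∂P, 1 ≤ M ω) (hsM : ((Real.log √β : ℝ) : EReal) ≤ mgfDomainSup P M)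
    (hτ : ∀ μ : ℝ, 0 < μ → IsTelegraphMotion P (β * μ) μ M (τ μ))
    {g : ℝ} (hg : 0 < g) (hgβ : 1 * g < β / g) :
    ∃ K : ℝ, 0 ≤ K ∧ ∀ μ : ℝ, 0 < μ → ∀ c,
      P {ω | tiltExponent β 1 g * c ≤ tiltExponent β 1 g * absorptionTime x M (τ μ) ω} ≤
        ENNReal.ofReal (K * Real.exp (μ * -(tiltExponent β 1 g * c - x * tiltLambda β 1 g))) := by
  have hfin := lintegral_ofReal_pow_ne_top (P := P) hsM hg (lt_sqrt_of_lt_div hg hgβ)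
  refine ⟨(∫⁻ ω, ENNReal.ofReal g ^ M ω ∂P).toReal, ENNReal.toReal_nonneg, fun μ hμ c => ?_⟩
  have H : IsTelegraphMotion P (β * μ) (1 * μ) M (τ μ) := by simpa using hτ μ hμ
  have hgμ : 1 * μ * g < β * μ / g := by
    have := mul_lt_mul_of_pos_right hgβ hμ
    calc 1 * μ * g = 1 * g * μ := by ring
      _ < β / g * μ := this
      _ = _ := by ring
  have h1 := H.measure_absorptionTime_le (by positivity) (mul_lt_mul_of_pos_right hβ hμ) hg hgμ
    hx.le hM hM_pos c
  rw [tiltExponent_mul, tiltLambda_mul] at h1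
  have e : {ω | μ * tiltExponent β 1 g * c ≤
      μ * tiltExponent β 1 g * absorptionTime x M (τ μ) ω} =
      {ω | tiltExponent β 1 g * c ≤ tiltExponent β 1 g * absorptionTime x M (τ μ) ω} := by
    ext ω
    simp only [Set.mem_ofPred_eq, mul_assoc]
    exact mul_le_mul_iff_right₀ hμ
  rw [e] at h1
  refine h1.trans (le_of_eq ?_)
  rw [ENNReal.ofReal_mul ENNReal.toReal_nonneg, ENNReal.ofReal_toReal hfin, mul_comm]
  congr 3
  ring

lemma upper_bound_absorptionTime (hx : 0 < x) (hβ : 1 < β) (hM : Measurable M)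
    (hM_pos : ∀ᵐ ω ∂P, 1 ≤ M ω) (hsM : ((Real.log √β : ℝ) : EReal) ≤ mgfDomainSup P M)
    (hτ : ∀ μ : ℝ, 0 < μ → IsTelegraphMotion P (β * μ) μ M (τ μ))
    {F : Set ℝ} (hF : IsClosed F) :
    limsup (fun μ : ℝ => ((1 / μ : ℝ) : EReal) *
        ENNReal.log (P (absorptionTime x M (τ μ) ⁻¹' F))) atTop ≤
      -⨅ z ∈ F, (x : EReal) * telegraphRate (z / x) β 1 := by
  by_contra! hcon
  obtain ⟨q, hq1, hq2⟩ := EReal.lt_iff_exists_real_btwn.1 hcon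
  have hr : ((-q : ℝ) : EReal) < ⨅ z ∈ F, (x : EReal) * telegraphRate (z / x) β 1 := by
    rw [EReal.coe_neg]; exact EReal.neg_lt_comm.1 hq1
  refine absurd hq2 (not_lt.2 ?_)
  rcases le_or_gt 0 q with hq0 | hq0
  · refine (limsup_inv_mul_log_le (K := 1) (ρ := 0) one_pos
      (Eventually.of_forall fun μ => ?_)).trans (by exact_mod_cast hq0)
    simpa using prob_le_one
  have hI : ∀ z ∈ F, ((-q : ℝ) : EReal) < (x : EReal) * telegraphRate (z / x) β 1 :=
    fun z hz => hr.trans_le (iInf₂_le z hz)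
  set m := x * (β + 1) / (β - 1) with hm
  have hmβ : m * (β - 1) = x * (β + 1) := by rw [hm]; field_simp [(by linarith : β - 1 ≠ 0)]
  have htan : ∀ g, 0 < g → tiltExponent β 1 g * m ≤ x * tiltLambda β 1 g := fun g hg => by
    have := tiltExponent_mul_le hβ hg
    refine le_of_mul_le_mul_right ?_ (by linarith : 0 < β - 1)
    rw [mul_assoc, hmβ]
    nlinarith
  -- The closed set is covered by a lower half-line that ends, and an upper half-line that starts,
  -- at a point of the set, on the two sides of the mean `m`.
  have hleft : ∃ K : ℝ, 0 ≤ K ∧ ∀ μ : ℝ, 0 < μ →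
      P (absorptionTime x M (τ μ) ⁻¹' (F ∩ Set.Iic m)) ≤
        ENNReal.ofReal (K * Real.exp (μ * q)) := by
    rcases (F ∩ Set.Iic m).eq_empty_or_nonempty with hne | hne
    · exact ⟨0, le_rfl, fun μ _ => by simp [hne]⟩
    have hbdd : BddAbove (F ∩ Set.Iic m) := ⟨m, fun z hz => hz.2⟩
    obtain ⟨hcF, hcm⟩ := (hF.inter isClosed_Iic).csSup_mem hne hbdd
    have hle : ∀ z ∈ F ∩ Set.Iic m, z ≤ sSup (F ∩ Set.Iic m) := fun z hz => le_csSup hbdd hz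
    set c := sSup (F ∩ Set.Iic m)
    have hcm : c ≤ m := hcm
    obtain ⟨g, hg, hgβ, hlt⟩ := exists_tilt_of_lt_rate hx hβ (hI c hcF)
    have hs : tiltExponent β 1 g < 0 := by
      by_contra! h0
      nlinarith [htan g hg]
    obtain ⟨K, hK, hP⟩ := exists_measure_absorptionTime_le hx hβ hM hM_pos hsM hτ hg hgβ
    refine ⟨K, hK, fun μ hμ => (measure_mono fun ω hω => ?_).trans ((hP μ hμ c).trans
      (ENNReal.ofReal_le_ofReal (mul_le_mul_of_nonneg_left (Real.exp_le_exp.2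
        (mul_le_mul_of_nonneg_left (by linarith) hμ.le)) hK)))⟩
    exact mul_le_mul_of_nonpos_left (hle _ hω) hs.le
  have hright : ∃ K : ℝ, 0 ≤ K ∧ ∀ μ : ℝ, 0 < μ →
      P (absorptionTime x M (τ μ) ⁻¹' (F ∩ Set.Ici m)) ≤
        ENNReal.ofReal (K * Real.exp (μ * q)) := by
    rcases (F ∩ Set.Ici m).eq_empty_or_nonempty with hne | hne
    · exact ⟨0, le_rfl, fun μ _ => by simp [hne]⟩
    have hbdd : BddBelow (F ∩ Set.Ici m) := ⟨m, fun z hz => hz.2⟩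
    obtain ⟨hcF, hcm⟩ := (hF.inter isClosed_Ici).csInf_mem hne hbdd
    have hle : ∀ z ∈ F ∩ Set.Ici m, sInf (F ∩ Set.Ici m) ≤ z := fun z hz => csInf_le hbdd hz
    set c := sInf (F ∩ Set.Ici m)
    have hcm : m ≤ c := hcm
    obtain ⟨g, hg, hgβ, hlt⟩ := exists_tilt_of_lt_rate hx hβ (hI c hcF)
    have hs : 0 < tiltExponent β 1 g := by
      by_contra! h0
      nlinarith [htan g hg]
    obtain ⟨K, hK, hP⟩ := exists_measure_absorptionTime_le hx hβ hM hM_pos hsM hτ hg hgβ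
    refine ⟨K, hK, fun μ hμ => (measure_mono fun ω hω => ?_).trans ((hP μ hμ c).trans
      (ENNReal.ofReal_le_ofReal (mul_le_mul_of_nonneg_left (Real.exp_le_exp.2
        (mul_le_mul_of_nonneg_left (by linarith) hμ.le)) hK)))⟩
    exact mul_le_mul_of_nonneg_left (hle _ hω) hs.le
  obtain ⟨K₁, hK₁, h₁⟩ := hleft
  obtain ⟨K₂, hK₂, h₂⟩ := hright
  refine limsup_inv_mul_log_le (K := K₁ + K₂ + 1) (by positivity) ?_
  filter_upwards [eventually_gt_atTop 0] with μ hμ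
  calc _ ≤ P (absorptionTime x M (τ μ) ⁻¹' (F ∩ Set.Iic m)) +
        P (absorptionTime x M (τ μ) ⁻¹' (F ∩ Set.Ici m)) := by
        refine (measure_mono fun ω hω => ?_).trans (measure_union_le _ _)
        rcases le_total (absorptionTime x M (τ μ) ω) m with h | h
        · exact .inl ⟨hω, h⟩
        · exact .inr ⟨hω, h⟩
    _ ≤ ENNReal.ofReal (K₁ * Real.exp (μ * q)) + ENNReal.ofReal (K₂ * Real.exp (μ * q)) :=
        add_le_add (h₁ μ hμ) (h₂ μ hμ)
    _ ≤ _ := by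
        rw [← ENNReal.ofReal_add (by positivity) (by positivity)]
        refine ENNReal.ofReal_le_ofReal ?_
        nlinarith [Real.exp_pos (μ * q)]

/-- Lower bound for the probability of a neighbourhood of the mean `z` of the tilted motion. -/
lemma exists_le_measure_absorptionTime (hx : 0 < x) (hβ : 1 < β)
    (hM_pos : ∀ᵐ ω ∂P, 1 ≤ M ω)
    (hτ : ∀ μ : ℝ, 0 < μ → IsTelegraphMotion P (β * μ) μ M (τ μ))
    {g z δ : ℝ} (hg : 0 < g) (hgβ : 1 * g < β / g)
    (hz : x * (β / g + 1 * g) = z * (β / g - 1 * g)) (hδ : 0 < δ) :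
    ∃ K : ℝ, 0 < K ∧ ∀ᶠ μ : ℝ in atTop,
      ENNReal.ofReal (K * Real.exp (μ * -(tiltExponent β 1 g * z - x * tiltLambda β 1 g +
        |tiltExponent β 1 g| * δ))) ≤ P {ω | |absorptionTime x M (τ μ) ω - z| < δ} := by
  obtain ⟨m, hm⟩ : ∃ m : ℕ, P (M ⁻¹' {m + 1}) ≠ 0 := by
    by_contra! hcon
    have h0 : P (⋃ m : ℕ, M ⁻¹' {m + 1}) = 0 := measure_iUnion_null hcon
    have h1 : ∀ᵐ ω ∂P, False := by
      filter_upwards [hM_pos, measure_eq_zero_iff_ae_notMem.1 h0] with ω h2 h3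
      exact h3 (Set.mem_iUnion.2 ⟨M ω - 1, (Nat.sub_add_cancel h2).symm⟩)
    simp at h1
    exact IsProbabilityMeasure.ne_zero P h1
  set p := P (M ⁻¹' {m + 1})
  have hp : p ≠ ∞ := measure_ne_top _ _
  set s := tiltExponent β 1 g
  set L := tiltLambda β 1 g
  set η := δ / (m + 1) with hη
  have hη0 : 0 < η := by positivity
  have hηδ : η ≤ δ := div_le_self hδ.le (by simp)
  refine ⟨p.toReal * 2⁻¹ ^ m * g * 2⁻¹, ?_, ?_⟩
  · have : 0 < p.toReal := ENNReal.toReal_pos hm hp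
    positivity
  filter_upwards [half_le_holdingLaw (a := β) (b := 1) (x := 0) (z := 0) one_pos hβ le_rfl
    (by simp) hη0, half_le_holdingLaw (mul_pos one_pos hg) hgβ hx.le hz hη0,
    eventually_gt_atTop 0] with μ h1 h2 hμ
  have H : IsTelegraphMotion P (β * μ) (1 * μ) M (τ μ) := by simpa using hτ μ hμ
  have hgμ : 1 * μ * g < β * μ / g := by
    have := mul_lt_mul_of_pos_right hgβ hμ
    calc 1 * μ * g = 1 * g * μ := by ring
      _ < β / g * μ := this
      _ = _ := by ring
  have hμ1 : 0 < 1 * μ := by positivity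
  have hμβ : 1 * μ < β * μ := mul_lt_mul_of_pos_right hβ hμ
  have h3 := H.le_measure_absorptionTime hμ1 hμβ hx.le hM_pos m z η
  have h4 := le_holdingLaw_abs_sub_lt hμ1 hμβ hg hgμ hx.le z η
  rw [tiltExponent_mul, tiltLambda_mul, show β * μ / g = β / g * μ by ring,
    show 1 * μ * g = 1 * g * μ by ring] at h4
  rw [show ((m : ℝ) + 1) * η = δ by rw [hη]; field_simp] at h3
  refine le_trans ?_ h3
  calc _ ≤ p * (2⁻¹ ^ m * (ENNReal.ofReal (g * Real.exp (μ * L * x - μ * s * z - |μ * s| * η)) *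
        2⁻¹)) := by
        have e2 : (2⁻¹ : ℝ≥0∞) = ENNReal.ofReal 2⁻¹ := by
          rw [ENNReal.ofReal_inv_of_pos two_pos]; simp
        rw [← ENNReal.ofReal_toReal hp, e2, ← ENNReal.ofReal_pow (by norm_num),
          ← ENNReal.ofReal_mul (by positivity), ← ENNReal.ofReal_mul (by positivity),
          ← ENNReal.ofReal_mul (by positivity), ENNReal.toReal_ofReal ENNReal.toReal_nonneg]
        refine ENNReal.ofReal_le_ofReal ?_
        have : Real.exp (μ * -(s * z - x * L + |s| * δ)) ≤
            Real.exp (μ * L * x - μ * s * z - |μ * s| * η) := by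
          rw [Real.exp_le_exp, abs_mul, abs_of_pos hμ]
          nlinarith [mul_le_mul_of_nonneg_left hηδ (mul_nonneg hμ.le (abs_nonneg s))]
        calc _ ≤ p.toReal * 2⁻¹ ^ m * g * 2⁻¹ *
              Real.exp (μ * L * x - μ * s * z - |μ * s| * η) :=
              mul_le_mul_of_nonneg_left this (by positivity)
          _ = _ := by ring
    _ ≤ _ := by
        refine mul_le_mul_right (mul_le_mul' (pow_le_pow_left' h1 m) (le_trans ?_ h4)) _
        exact mul_le_mul_right h2 _

lemma lower_bound_absorptionTime (hx : 0 < x) (hβ : 1 < β)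
    (hM_pos : ∀ᵐ ω ∂P, 1 ≤ M ω)
    (hτ : ∀ μ : ℝ, 0 < μ → IsTelegraphMotion P (β * μ) μ M (τ μ))
    {G : Set ℝ} (hG : IsOpen G) :
    -⨅ z ∈ G, (x : EReal) * telegraphRate (z / x) β 1 ≤
      liminf (fun μ : ℝ => ((1 / μ : ℝ) : EReal) *
        ENNReal.log (P (absorptionTime x M (τ μ) ⁻¹' G))) atTop := by
  by_contra! hcon
  obtain ⟨q, hq1, hq2⟩ := EReal.lt_iff_exists_real_btwn.1 hcon
  have hr : ⨅ z ∈ G, (x : EReal) * telegraphRate (z / x) β 1 < ((-q : ℝ) : EReal) := by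
    rw [EReal.coe_neg]; exact EReal.lt_neg_comm.1 hq2
  obtain ⟨z, hz⟩ := iInf_lt_iff.1 hr
  obtain ⟨hzG, hz⟩ := iInf_lt_iff.1 hz
  refine absurd hq1 (not_lt.2 ?_)
  have hzx : x ≤ z := by
    by_contra! hlt
    rw [rate_eq_top hx hβ hlt] at hz
    exact not_top_lt hz
  -- The rate changed by the factor `g` for which the mean arrival time is a given `y > x`.
  have hmean : ∀ y, x < y → ∃ g, 0 < g ∧ 1 * g < β / g ∧
      x * (β / g + 1 * g) = y * (β / g - 1 * g) ∧ g ^ 2 * (y + x) = β * (y - x) := by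
    intro y hy
    have h1 : 0 < β * (y - x) / (y + x) :=
      div_pos (mul_pos (by linarith) (by linarith)) (by linarith)
    have h2 : √(β * (y - x) / (y + x)) ^ 2 = β * (y - x) / (y + x) := Real.sq_sqrt h1.le
    have h3 := Real.sqrt_pos.2 h1
    set g := √(β * (y - x) / (y + x))
    rw [eq_div_iff (by linarith)] at h2
    refine ⟨g, h3, ?_, ?_, h2⟩
    · rw [one_mul, lt_div_iff₀ h3]
      by_contra! h4
      nlinarith
    · field_simp
      linarith
  obtain ⟨y, g, hyG, hg, hgβ, hyg, hlt⟩ : ∃ y g, y ∈ G ∧ 0 < g ∧ 1 * g < β / g ∧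
      x * (β / g + 1 * g) = y * (β / g - 1 * g) ∧
      tiltExponent β 1 g * y - x * tiltLambda β 1 g < -q := by
    have hle : ∀ g, 0 < g → 1 * g < β / g →
        tiltExponent β 1 g * z - x * tiltLambda β 1 g < -q := fun g hg hgβ => by
      have h1 := (le_mul_telegraphRate hx z (tiltExponent_le hβ hg)).trans_lt hz
      rwa [EReal.coe_lt_coe_iff, telegraphLambda_tiltExponent hg hgβ] at h1
    rcases hzx.eq_or_lt with rfl | hzx
    · -- At the end point of the domain a mean slightly above `x` is taken, with an exponent `≤ 0`.
      have hx2 : x < x * (β + 1) / (β - 1) := by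
        rw [lt_div_iff₀ (by linarith)]; nlinarith
      obtain ⟨y, ⟨hyG, hy2⟩, hy1⟩ := ((((hG.eventually_mem hzG).and
        (eventually_lt_nhds hx2)).filter_mono nhdsWithin_le_nhds).and (self_mem_nhdsWithin : Set.Ioi x ∈ 𝓝[>] x)).exists
      have hy1 : x < y := hy1
      have hy2 : y < x * (β + 1) / (β - 1) := hy2
      rw [lt_div_iff₀ (by linarith)] at hy2
      obtain ⟨g, hg, hgβ, hyg, hg2⟩ := hmean y hy1
      have hg1 : g ≤ 1 := by
        by_contra! h1
        have h2 : 0 < g ^ 2 - 1 := by nlinarith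
        nlinarith [mul_pos h2 (by linarith : 0 < y + x)]
      have hs : tiltExponent β 1 g ≤ 0 := by
        rw [tiltExponent_eq hg]
        refine mul_nonpos_of_nonpos_of_nonneg (by linarith) ?_
        rw [sub_nonneg, le_div_iff₀ hg]; linarith
      refine ⟨y, g, hyG, hg, hgβ, hyg, lt_of_le_of_lt ?_ (hle g hg hgβ)⟩
      nlinarith
    · obtain ⟨g, hg, hgβ, hyg, -⟩ := hmean z hzx
      exact ⟨z, g, hzG, hg, hgβ, hyg, hle g hg hgβ⟩
  obtain ⟨δ₀, hδ₀, hball⟩ := Metric.isOpen_iff.1 hG y hyG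
  set s := tiltExponent β 1 g
  set ε := -q - (s * y - x * tiltLambda β 1 g) with hε
  have hε0 : 0 < ε := by linarith
  have hs1 : 0 < |s| + 1 := by positivity
  set δ := min δ₀ (ε / (|s| + 1))
  have hδ : 0 < δ := lt_min hδ₀ (by positivity)
  have hsδ : |s| * δ ≤ ε := by
    have : δ * (|s| + 1) ≤ ε := (le_div_iff₀ hs1).1 (min_le_right _ _)
    linarith
  obtain ⟨K, hK, hP⟩ := exists_le_measure_absorptionTime hx hβ hM_pos hτ hg hgβ hyg hδ
  refine le_liminf_inv_mul_log hK ?_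
  filter_upwards [hP, eventually_gt_atTop 0] with μ h1 hμ
  refine le_trans (ENNReal.ofReal_le_ofReal (mul_le_mul_of_nonneg_left (Real.exp_le_exp.2
    (mul_le_mul_of_nonneg_left ?_ hμ.le)) hK.le)) (h1.trans (measure_mono fun ω hω => ?_))
  · linarith
  · have hω : |absorptionTime x M (τ μ) ω - y| < δ := hω
    refine hball ?_
    rw [Metric.mem_ball, Real.dist_eq]
    exact hω.trans_le (min_le_left _ _)

end LargeDeviations

theorem proposition4p1 {Ω : Type*} [MeasurableSpace Ω] (P : Measure Ω) [IsProbabilityMeasure P]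
    (x β : ℝ) (hx : 0 < x) (hβ : 1 < β)
    (M : Ω → ℕ) (hM : Measurable M) (hM_pos : ∀ᵐ ω ∂P, 1 ≤ M ω)
    (hsM : ((Real.log √β : ℝ) : EReal) ≤ mgfDomainSup P M)
    (τ : ℝ → ℕ → ℕ → Ω → ℝ)
    (hτ : ∀ μ : ℝ, 0 < μ → IsTelegraphMotion P (β * μ) μ M (τ μ)) :
    IsGoodRateFunction (fun z : ℝ => (x : EReal) * telegraphRate (z / x) β 1) ∧
    SatisfiesLDP P (fun μ : ℝ => absorptionTime x M (τ μ)) (fun μ : ℝ => μ)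
      (fun z : ℝ => (x : EReal) * telegraphRate (z / x) β 1) := by

  have hgood := isGoodRateFunction_mul_telegraphRate hx hβ
  refine ⟨hgood, fun μ hμ => ?_, tendsto_id, hgood.toIsRateFunction,
    fun F hF => upper_bound_absorptionTime hx hβ hM hM_pos hsM hτ hF,
    fun G hG => lower_bound_absorptionTime hx hβ hM_pos hτ hG⟩
  exact (hτ μ hμ).aemeasurable_absorptionTime hμ (by nlinarith) hx.le hM hM_pos
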